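/- Let $G$ be a finite directed graph (loops and multiple edges allowed) with vertex set $\mathcal V$ and nonempty edge set $\mathcal E$, and suppose that $G$ is strongly connected. Write $s(e)$ and $r(e)$ for the initial and the final vertex of $e\in\mathcal E$. Let $\mathcal E^-=\{e^-:e\in\mathcal E\}$ and $\mathcal E^+=\{e^+:e\in\mathcal E\}$ be two disjoint copies of $\mathcal E$. The graph inverse semigroup of $G$ is the semigroup with zero generated by $\mathcal E^-\cup\{P_v:v\in\mathcal V\}\cup\mathcal E^+$ with the relations $$P_v^2=P_v,\qquad P_uP_w=0\ (u\neq w),\qquad P_{s(e)}e^-=e^-=e^-P_{r(e)},\qquad P_{r(e)}e^+=e^+=e^+P_{s(e)},$$ $$e^-e^+=P_{s(e)},\qquad f^-g^+=0\ (f\ne g),\qquad g^+f^-=0\ (s(f)\neq s(g)),\qquad f^-g^-=0\ (r(f)\neq s(g)).$$ The Markov-Dyck shift $D_G\subset(\mathcal E^-\cup\mathcal E^+)^{\mathbb Z}$ is the set of all bi-infinite sequences all of whose finite blocks have a nonzero product in this semigroup. Its topological entropy is $h(D_G)=\lim_{n\to\infty}\frac1n\log\operatorname{card}\mathcal L_n(D_G)$,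 where $\mathcal L_n(D_G)$ is the set of words of length $n$ that appear in points of $D_G$. Let $A_G$ be the adjacency matrix of $G$, whose entry $A_G(u,w)$ is the number of edges from $u$ to $w$; let $\rho$ be the inverse of its Perron eigenvalue (its spectral radius); let $p(z)=\det(I-A_Gz)$; for $v\in\mathcal V$ let $p_v(z)$ be the determinant of the matrix $I-A_Gz$ with the $v$-th row and the $v$-th column deleted, and put $q_v=p/p_v$. If $\rho<\frac14$, then the limit defining $h(D_G)$ exists, the set $\{v\in\mathcal V:q_v(\rho^2)>\frac34\}$ is not empty, and $$h(D_G)>-\log\rho+\max_{\{v\in\mathcal V\,:\,q_v(\rho^2)>\frac34\}}\frac{p_v(\rho)\Bigl[q_v(\rho^2)-\frac34-\frac12\sqrt{q_v(\rho^2)-\frac34}\Bigr]}{\rho\,p'(\rho)\Bigl[\rho+\sqrt{q_v(\rho^2)-\frac34}\Bigr]}.$$ -/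

import Mathlib

/-- A directed graph (loops and multiple edges allowed) with vertex set `V` and edge set `E`;
`src e` is the initial vertex and `tgt e` the final vertex of the edge `e`. -/
structure DiMultigraph (V E : Type*) where
  src : E → V
  tgt : E → V

namespace DiMultigraph

variable {V E : Type*}

/-- For all vertices `u`, `w` there is a directed path from `u` to `w`. -/
def StronglyConnected (G : DiMultigraph V E) : Prop :=
  ∀ u w : V, Relation.ReflTransGen (fun a b => ∃ e, G.src e = a ∧ G.tgt e = b) u w

/-- The adjacency matrix: the entry `(u, w)` is the number of edges from `u` to `w`. -/
noncomputable def adjMatrix (G : DiMultigraph V E) (R : Type*) [NatCast R] : Matrix V V R :=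
  Matrix.of fun u w => ((Set.ncard {e : E | G.src e = u ∧ G.tgt e = w} : ℕ) : R)

end DiMultigraph

/-- The alphabet of the Markov-Dyck shift: two disjoint copies `e⁻`, `e⁺` of the edge set. -/
inductive DyckLetter (E : Type*) where
  | neg (e : E)
  | pos (e : E)

/-- The generators of the graph inverse semigroup: the letters `e⁻`, `e⁺` and the idempotents
`P_v`, one for each vertex `v`. -/
inductive GraphInvGen (V E : Type*) where
  | letter (a : DyckLetter E)
  | idem (v : V)

namespace DiMultigraph

variable {V E : Type*}

/-- The free monoid with zero on the generators. -/
abbrev FreeGen (V E : Type*) := WithZero (FreeMonoid (GraphInvGen V E))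

/-- The idempotent `P_v` as an element of the free monoid with zero. -/
def genP (E : Type*) {V : Type*} (v : V) : FreeGen V E :=
  ((FreeMonoid.of (GraphInvGen.idem v) : FreeMonoid (GraphInvGen V E)) : FreeGen V E)

/-- The letter `e⁻` as an element of the free monoid with zero. -/
def genNeg (V : Type*) {E : Type*} (e : E) : FreeGen V E :=
  ((FreeMonoid.of (GraphInvGen.letter (DyckLetter.neg e)) :
    FreeMonoid (GraphInvGen V E)) : FreeGen V E)

/-- The letter `e⁺` as an element of the free monoid with zero. -/
def genPos (V : Type*) {E : Type*} (e : E) : FreeGen V E :=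
  ((FreeMonoid.of (GraphInvGen.letter (DyckLetter.pos e)) :
    FreeMonoid (GraphInvGen V E)) : FreeGen V E)

/-- The defining relations of the graph inverse semigroup of `G`. -/
inductive GraphInvRel (G : DiMultigraph V E) : FreeGen V E → FreeGen V E → Prop
  /-- `P_v P_v = P_v` -/
  | idem (v : V) : GraphInvRel G (genP E v * genP E v) (genP E v)
  /-- `P_u P_w = 0` for `u ≠ w` -/
  | orth (u w : V) : u ≠ w → GraphInvRel G (genP E u * genP E w) 0
  /-- `P_{s(e)} e⁻ = e⁻` -/
  | src_neg (e : E) : GraphInvRel G (genP E (G.src e) * genNeg V e) (genNeg V e)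
  /-- `e⁻ P_{r(e)} = e⁻` -/
  | neg_tgt (e : E) : GraphInvRel G (genNeg V e * genP E (G.tgt e)) (genNeg V e)
  /-- `P_{r(e)} e⁺ = e⁺` -/
  | tgt_pos (e : E) : GraphInvRel G (genP E (G.tgt e) * genPos V e) (genPos V e)
  /-- `e⁺ P_{s(e)} = e⁺` -/
  | pos_src (e : E) : GraphInvRel G (genPos V e * genP E (G.src e)) (genPos V e)
  /-- `e⁻ e⁺ = P_{s(e)}` -/
  | cancel (e : E) : GraphInvRel G (genNeg V e * genPos V e) (genP E (G.src e))
  /-- `f⁻ g⁺ = 0` for `f ≠ g` -/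
  | neg_pos (f g : E) : f ≠ g → GraphInvRel G (genNeg V f * genPos V g) 0
  /-- `g⁺ f⁻ = 0` for `s(f) ≠ s(g)` -/
  | pos_neg (f g : E) : G.src f ≠ G.src g → GraphInvRel G (genPos V g * genNeg V f) 0
  /-- `f⁻ g⁻ = 0` for `r(f) ≠ s(g)` -/
  | neg_neg (f g : E) : G.tgt f ≠ G.src g → GraphInvRel G (genNeg V f * genNeg V g) 0

/-- The graph inverse semigroup of `G`, given by generators and relations, with an identity
adjoined (which only serves as the value of the empty product). -/
abbrev GraphInvSemigroup (G : DiMultigraph V E) := (conGen G.GraphInvRel).Quotient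

/-- The product in the graph inverse semigroup of a word in the letters `e⁻`, `e⁺`. -/
def wordProd (G : DiMultigraph V E) (w : List (DyckLetter E)) : G.GraphInvSemigroup :=
  (w.map fun a => (((FreeMonoid.of (GraphInvGen.letter a) :
    FreeMonoid (GraphInvGen V E)) : FreeGen V E) : G.GraphInvSemigroup)).prod

/-- The Markov-Dyck shift `D_G`: the bi-infinite sequences of letters `e⁻`, `e⁺` all of whose
finite blocks `x_i x_{i+1} ⋯ x_{i+n-1}` have a nonzero product. -/
def markovDyckShift (G : DiMultigraph V E) : Set (ℤ → DyckLetter E) :=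
  {x | ∀ (i : ℤ) (n : ℕ),
    G.wordProd (List.ofFn fun k : Fin n => x (i + (k : ℤ))) ≠
      ((0 : FreeGen V E) : G.GraphInvSemigroup)}

end DiMultigraph

/-- The words of length `n` that appear in a point of `X ⊆ A^ℤ`. -/
def subshiftWords {A : Type*} (X : Set (ℤ → A)) (n : ℕ) : Set (Fin n → A) :=
  {w | ∃ x ∈ X, ∃ i : ℤ, ∀ k : Fin n, w k = x (i + (k : ℤ))}

/-- `h` is the topological entropy of the subshift `X`: the limit of `(1/n) log card L_n(X)`
exists and equals `h`. -/
def HasTopEntropy {A : Type*} (X : Set (ℤ → A)) (h : ℝ) : Prop :=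
  Filter.Tendsto (fun n : ℕ => 1 / (n : ℝ) * Real.log ((subshiftWords X n).ncard : ℝ))
    Filter.atTop (nhds h)

namespace DiMultigraph

variable {V E : Type*} [Fintype V] [DecidableEq V]

/-- The inverse of the Perron eigenvalue (the spectral radius) of the adjacency matrix. -/
noncomputable def rho (G : DiMultigraph V E) : ℝ :=
  (spectralRadius ℂ (G.adjMatrix ℂ)).toReal⁻¹

/-- `p(z) = det (I - A_G z)`. -/
noncomputable def p (G : DiMultigraph V E) : Polynomial ℝ :=
  (G.adjMatrix ℝ).charpolyRev

/-- `p_v(z)`: the determinant of `I - A_G z` with the `v`-th row and column deleted. -/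
noncomputable def pDel (G : DiMultigraph V E) (v : V) : Polynomial ℝ :=
  ((G.adjMatrix ℝ).submatrix (Subtype.val : {w : V // w ≠ v} → V) Subtype.val).charpolyRev

/-- `q_v(z) = p(z) / p_v(z)`. -/
noncomputable def q (G : DiMultigraph V E) (v : V) (z : ℝ) : ℝ :=
  G.p.eval z / (G.pDel v).eval z

/-- The explicit term in the entropy estimate at the vertex `v`. -/
noncomputable def entropyTerm (G : DiMultigraph V E) (v : V) : ℝ :=
  ((G.pDel v).eval G.rho *
      (G.q v (G.rho ^ 2) - 3 / 4 - 1 / 2 * √(G.q v (G.rho ^ 2) - 3 / 4))) /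
    (G.rho * (Polynomial.derivative G.p).eval G.rho *
      (G.rho + √(G.q v (G.rho ^ 2) - 3 / 4)))

end DiMultigraph

/-! Fix a vertex v and let R(z) be the generating function, by length, of the first return loops at
v. A stack machine (`e⁻` pushes, `e⁺` pops) satisfies the defining relations, so a word on which it
runs has nonzero product. Let D(z) count the words taking v with empty stack to itself, and N(z)
those taking v with empty stack to v with any stack.

Only lower bounds are needed. The words c⁻ d c⁺ d' decompose uniquely, so D ≥ 1 + R(z²)D²; so do the
words d c⁻ w, so N ≥ 1 + D R(z) N. If N(z) is finite, the first bound forces 1/D ≤ 1/2 + √(1/4 -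
R(z²)) and the second D R(z) < 1. Hence N diverges once R(z) > 1/2 + √(1/4 - R(z²))
(`tsum_negWord_eq_top`). Periodic repetition puts the words counted by N into the shift, so
divergence at z gives h ≥ -log z.

The renewal equation p = (1 - R) p_v (`eval_p_eq`) turns this into determinants: q_v = 1 - R, R(ρ) =
1, and ρR'(ρ) is at most M = -ρp'(ρ)/p_v(ρ). Loops have length at least 1, so R(ρ²) ≤ ρR(ρ) = ρ <
1/4, and every vertex has q_v(ρ²) > 3/4.

Put z = ρe^{-t} and c = q_v(ρ²) - 3/4. At t = 0 the two sides of the criterion differ by 1/2 - √c,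
and the difference falls at rate at most M(1 + ρ/√c). One Newton step in t is exactly the stated
term, and strict convexity keeps the criterion true slightly beyond it (`exists_gt_newton_step`),
whence the strict inequality. -/

section Perron

/-! ### Perron's theorem for irreducible nonnegative matrices -/

open Filter Topology

variable {V : Type*} [Fintype V] [DecidableEq V]

attribute [local instance] Matrix.linftyOpNormedRing Matrix.linftyOpNormedAlgebra

theorem Matrix.pow_smul_le_pow_mulVec {A : Matrix V V ℝ} (hA : ∀ u w, 0 ≤ A u w) {y : V → ℝ}
    {t : ℝ} (ht : 0 ≤ t) (h : ∀ u, t * y u ≤ A.mulVec y u) (n : ℕ) (u : V) :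
    t ^ n * y u ≤ (A ^ n).mulVec y u := by
  induction n generalizing u with
  | zero => simp
  | succ n ih =>
    rw [pow_succ' A, ← Matrix.mulVec_mulVec]
    calc t ^ (n + 1) * y u = t ^ n * (t * y u) := by ring
      _ ≤ t ^ n * A.mulVec y u := by gcongr; exact h u
      _ = ∑ w, A u w * (t ^ n * y w) := by
        simp only [Matrix.mulVec, dotProduct, Finset.mul_sum]
        exact Finset.sum_congr rfl fun w _ => by ring
      _ ≤ A.mulVec ((A ^ n).mulVec y) u := by
        simp only [Matrix.mulVec, dotProduct]
        exact Finset.sum_le_sum fun w _ => mul_le_mul_of_nonneg_left (ih w) (hA u w)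

/-- Collatz–Wielandt lower bound: iteration gives ‖Aⁿ‖ ≥ κtⁿ with κ > 0 independent of n, and κ
disappears in Gelfand's formula. -/
theorem Matrix.ofReal_le_spectralRadius {A : Matrix V V ℝ} (hA : ∀ u w, 0 ≤ A u w) {y : V → ℝ}
    {t : ℝ} (ht : 0 ≤ t) (h : ∀ u, t * y u ≤ A.mulVec y u) {u : V} (hu : 0 < y u) :
    ENNReal.ofReal t ≤ spectralRadius ℂ (A.map ((↑) : ℝ → ℂ)) := by
  have : CompleteSpace (Matrix V V ℂ) := FiniteDimensional.complete ℂ _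
  set a : Matrix V V ℂ := A.map ((↑) : ℝ → ℂ) with ha
  have hlim := spectrum.pow_norm_pow_one_div_tendsto_nhds_spectralRadius a
  set y' : V → ℂ := fun w => (y w : ℂ)
  have hy' : 0 < ‖y'‖ := by
    refine norm_pos_iff.2 fun h0 => hu.ne' ?_
    have := congrFun h0 u
    simpa [y'] using this
  have hκ : 0 < y u / ‖y'‖ := div_pos hu hy'
  have hbound : ∀ n : ℕ, t ^ n * (y u / ‖y'‖) ≤ ‖a ^ n‖ := by
    intro n
    rw [mul_div_assoc', div_le_iff₀ hy']
    have h1 : a ^ n = (A ^ n).map ((↑) : ℝ → ℂ) := by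
      have := map_pow (Complex.ofRealHom.mapMatrix (m := V)) A n
      exact this.symm
    have h2 : (a ^ n).mulVec y' u = (((A ^ n).mulVec y u : ℝ) : ℂ) := by
      rw [h1]; simp [Matrix.mulVec, dotProduct, y']
    calc t ^ n * y u ≤ (A ^ n).mulVec y u := Matrix.pow_smul_le_pow_mulVec hA ht h n u
      _ ≤ ‖(a ^ n).mulVec y' u‖ := by rw [h2, Complex.norm_real]; exact le_abs_self _
      _ ≤ ‖(a ^ n).mulVec y'‖ := norm_le_pi_norm _ u
      _ ≤ _ := Matrix.linfty_opNorm_mulVec _ _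
  have hκlim : Tendsto (fun n : ℕ => ENNReal.ofReal (t * (y u / ‖y'‖) ^ (1 / n : ℝ))) atTop
      (𝓝 (ENNReal.ofReal t)) := by
    refine ENNReal.tendsto_ofReal ?_
    have h0 : Tendsto (fun n : ℕ => (1 / n : ℝ)) atTop (𝓝 0) := tendsto_one_div_atTop_nhds_zero_nat
    have := ((Real.continuous_const_rpow hκ.ne').tendsto 0).comp h0
    simpa using this.const_mul t
  refine le_of_tendsto_of_tendsto hκlim hlim ?_
  filter_upwards [eventually_ge_atTop 1] with n hn
  refine ENNReal.ofReal_le_ofReal ?_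
  have hn' : n ≠ 0 := by omega
  calc t * (y u / ‖y'‖) ^ (1 / n : ℝ) = (t ^ n * (y u / ‖y'‖)) ^ (1 / n : ℝ) := by
        rw [Real.mul_rpow (by positivity) hκ.le, one_div, Real.pow_rpow_inv_natCast ht hn']
    _ ≤ _ := Real.rpow_le_rpow (by positivity) (hbound n) (by positivity)

theorem Matrix.pow_one_add_mulVec_nonneg {A : Matrix V V ℝ} (hA : ∀ u w, 0 ≤ A u w) {y : V → ℝ}
    (hy : ∀ u, 0 ≤ y u) (n : ℕ) (u : V) : 0 ≤ ((1 + A) ^ n).mulVec y u := by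
  induction n generalizing u with
  | zero => simpa using hy u
  | succ n ih =>
    rw [pow_succ', ← Matrix.mulVec_mulVec, Matrix.add_mulVec, Matrix.one_mulVec, Pi.add_apply]
    refine add_nonneg (ih u) ?_
    exact Finset.sum_nonneg fun w _ => mul_nonneg (hA u w) (ih w)

/-- Positivity spreads backwards along paths, and the summand 1 preserves it once reached, so one
exponent serves all vertices. -/
theorem Matrix.exists_pow_one_add_mulVec_pos {A : Matrix V V ℝ} (hA : ∀ u w, 0 ≤ A u w)
    (hirr : ∀ u w, Relation.ReflTransGen (fun a b => 0 < A a b) u w) {y : V → ℝ}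
    (hy : ∀ u, 0 ≤ y u) (hy0 : y ≠ 0) : ∃ N : ℕ, ∀ n ≥ N, ∀ u, 0 < ((1 + A) ^ n).mulVec y u := by
  have hstep : ∀ n u, ((1 + A) ^ (n + 1)).mulVec y u =
      ((1 + A) ^ n).mulVec y u + ∑ w, A u w * ((1 + A) ^ n).mulVec y w := by
    intro n u
    rw [pow_succ', ← Matrix.mulVec_mulVec, Matrix.add_mulVec, Matrix.one_mulVec, Pi.add_apply]
    rfl
  have hnn := Matrix.pow_one_add_mulVec_nonneg hA hy
  obtain ⟨w₀, hw₀⟩ : ∃ w, 0 < y w := by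
    obtain ⟨w, hw⟩ := Function.ne_iff.1 hy0
    exact ⟨w, lt_of_le_of_ne (hy w) (Ne.symm hw)⟩
  have key : ∀ u, ∃ N : ℕ, ∀ n ≥ N, 0 < ((1 + A) ^ n).mulVec y u := by
    intro u
    induction hirr u w₀ using Relation.ReflTransGen.head_induction_on with
    | refl =>
      refine ⟨0, fun n _ => ?_⟩
      induction n with
      | zero => simpa using hw₀
      | succ n ih =>
        rw [hstep]
        exact add_pos_of_pos_of_nonneg (ih (Nat.zero_le _))
          (Finset.sum_nonneg fun w _ => mul_nonneg (hA _ w) (hnn n w))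
    | head hab _ ih =>
      obtain ⟨N, hN⟩ := ih
      refine ⟨N + 1, fun n hn => ?_⟩
      obtain ⟨m, rfl⟩ : ∃ m, n = m + 1 := ⟨n - 1, by omega⟩
      rw [hstep]
      refine add_pos_of_nonneg_of_pos (hnn m _) ?_
      exact Finset.sum_pos' (fun w _ => mul_nonneg (hA _ w) (hnn m w))
        ⟨_, Finset.mem_univ _, mul_pos hab (hN m (by omega))⟩
  choose N hN using key
  exact ⟨Finset.univ.sup N, fun n hn u =>
    hN u n ((Finset.le_sup (Finset.mem_univ u)).trans hn)⟩

/-- Perron's theorem: an irreducible nonnegative matrix has a positive eigenvector, and its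
eigenvalue is the spectral radius. -/
theorem Matrix.exists_pos_eigenvector [Nonempty V] {A : Matrix V V ℝ} (hA : ∀ u w, 0 ≤ A u w)
    (hirr : ∀ u w, Relation.ReflTransGen (fun a b => 0 < A a b) u w) :
    ∃ x : V → ℝ, (∀ u, 0 < x u) ∧
      A.mulVec x = (spectralRadius ℂ (A.map ((↑) : ℝ → ℂ))).toReal • x := by
  have : CompleteSpace (Matrix V V ℂ) := FiniteDimensional.complete ℂ _
  set a : Matrix V V ℂ := A.map ((↑) : ℝ → ℂ) with ha
  obtain ⟨μ, hμ, hμr⟩ := spectrum.exists_nnnorm_eq_spectralRadius a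
  have hlam : (spectralRadius ℂ a).toReal = ‖μ‖ := by rw [← hμr]; simp
  have hrad : spectralRadius ℂ a = ENNReal.ofReal ‖μ‖ := by
    rw [← hμr, ofReal_norm]; rfl
  rw [hlam]
  obtain ⟨y, hy0, hy⟩ : ∃ y : V → ℂ, y ≠ 0 ∧ a.mulVec y = μ • y := by
    rw [spectrum.mem_iff, Matrix.isUnit_iff_isUnit_det, isUnit_iff_ne_zero, not_not,
      ← Matrix.exists_mulVec_eq_zero_iff] at hμ
    obtain ⟨y, hy0, hy⟩ := hμ
    refine ⟨y, hy0, ?_⟩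
    rw [Matrix.sub_mulVec, sub_eq_zero, Algebra.algebraMap_eq_smul_one, Matrix.smul_mulVec,
      Matrix.one_mulVec] at hy
    exact hy.symm
  -- Moduli of an eigenvector for an eigenvalue of maximal modulus; the triangle inequality gives
  -- ‖μ‖x ≤ Ax.
  set x : V → ℝ := fun u => ‖y u‖ with hx
  have hxnn : ∀ u, 0 ≤ x u := fun u => norm_nonneg _
  have hx0 : x ≠ 0 := by
    intro h
    apply hy0
    ext u
    simpa [hx] using congrFun h u
  have hle : ∀ u, ‖μ‖ * x u ≤ A.mulVec x u := by
    intro u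
    have h1 : ‖μ‖ * x u = ‖a.mulVec y u‖ := by rw [hy]; simp [hx]
    rw [h1]
    refine (norm_sum_le _ _).trans (le_of_eq ?_)
    refine Finset.sum_congr rfl fun w _ => ?_
    simp [ha, hx, abs_of_nonneg (hA u w)]
  have hcomm : ∀ n : ℕ, A * (1 + A) ^ n = (1 + A) ^ n * A := fun n =>
    ((Commute.one_right A).add_right (Commute.refl A)).pow_right n
  have heig : A.mulVec x = ‖μ‖ • x := by
    -- Otherwise a power of 1 + A, which commutes with A, makes the inequality strict in every
    -- coordinate; the least quotient (Az)_u / z_u is then a lower bound for the spectral radius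
    -- that exceeds it.
    by_contra hne
    have hw0 : A.mulVec x - ‖μ‖ • x ≠ 0 := sub_ne_zero.2 hne
    have hwnn : ∀ u, 0 ≤ (A.mulVec x - ‖μ‖ • x) u := fun u => sub_nonneg.2 (hle u)
    obtain ⟨N₁, h₁⟩ := Matrix.exists_pow_one_add_mulVec_pos hA hirr hwnn hw0
    obtain ⟨N₂, h₂⟩ := Matrix.exists_pow_one_add_mulVec_pos hA hirr hxnn hx0
    set z := ((1 + A) ^ (max N₁ N₂)).mulVec x with hz
    have hzpos : ∀ u, 0 < z u := h₂ _ (le_max_right _ _)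
    have hgt : ∀ u, ‖μ‖ * z u < A.mulVec z u := by
      intro u
      have := h₁ _ (le_max_left N₁ N₂) u
      rw [Matrix.mulVec_sub, Matrix.mulVec_smul, Matrix.mulVec_mulVec, ← hcomm,
        ← Matrix.mulVec_mulVec, ← hz] at this
      simpa using this
    obtain ⟨u₀, -, hu₀⟩ := Finset.exists_min_image Finset.univ (fun u => A.mulVec z u / z u)
      Finset.univ_nonempty
    have hspec := Matrix.ofReal_le_spectralRadius hA (y := z) (t := A.mulVec z u₀ / z u₀)
      (div_nonneg ((mul_nonneg (norm_nonneg _) (hzpos u₀).le).trans (hgt u₀).le) (hzpos u₀).le)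
      (fun u => by
        have := hu₀ u (Finset.mem_univ u)
        rwa [le_div_iff₀ (hzpos u)] at this) (hzpos u₀)
    rw [← ha, hrad, ENNReal.ofReal_le_ofReal_iff (norm_nonneg _), div_le_iff₀ (hzpos u₀)] at hspec
    exact absurd (hgt u₀) (not_lt.2 hspec)
  refine ⟨x, ?_, heig⟩
  obtain ⟨N, hN⟩ := Matrix.exists_pow_one_add_mulVec_pos hA hirr hxnn hx0
  have hpow : ∀ n : ℕ, ((1 + A) ^ n).mulVec x = (1 + ‖μ‖) ^ n • x := by
    intro n
    induction n with
    | zero => simp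
    | succ n ih =>
      rw [pow_succ', ← Matrix.mulVec_mulVec, ih, Matrix.mulVec_smul, Matrix.add_mulVec,
        Matrix.one_mulVec, heig, pow_succ, mul_smul, add_smul, one_smul]
  intro u
  have := hN N le_rfl u
  rw [hpow] at this
  exact pos_of_mul_pos_right (by simpa using this) (by positivity)

end Perron

namespace DiMultigraph

variable {V E : Type*}

/-! ### The stack machine, a model of the graph inverse semigroup -/

section StackMachine

open Classical in
/-- The partial action of the generators of the graph inverse semigroup on pairs consisting of a
current vertex and a stack of edges: `e⁻` pushes `e`, `e⁺` pops `e`, and `P_v` tests whether the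
current vertex is `v`. -/
noncomputable def genStep (G : DiMultigraph V E) (s : V × List E) :
    GraphInvGen V E → Option (V × List E)
  | .letter (.neg e) => if s.1 = G.src e then some (G.tgt e, e :: s.2) else none
  | .letter (.pos e) => if s.1 = G.tgt e ∧ s.2.head? = some e then some (G.src e, s.2.tail) else none
  | .idem v => if s.1 = v then some s else none

/-- The action of the free monoid with zero on the states of the stack machine. -/
noncomputable def freeAct (G : DiMultigraph V E) : FreeGen V E → V × List E → Option (V × List E) :=
  WithZero.recZeroCoe (fun _ => none) fun w s => (FreeMonoid.toList w).foldlM G.genStep s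

theorem freeAct_zero (G : DiMultigraph V E) (s : V × List E) : G.freeAct 0 s = none := rfl

theorem freeAct_coe (G : DiMultigraph V E) (w : FreeMonoid (GraphInvGen V E)) (s : V × List E) :
    G.freeAct (w : FreeGen V E) s = (FreeMonoid.toList w).foldlM G.genStep s := rfl

theorem freeAct_mul (G : DiMultigraph V E) (a b : FreeGen V E) (s : V × List E) :
    G.freeAct (a * b) s = G.freeAct a s >>= G.freeAct b := by
  induction a using WithZero.recZeroCoe with
  | zero => rw [zero_mul]; rfl
  | coe a =>
    induction b using WithZero.recZeroCoe with
    | zero =>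
      rw [mul_zero]
      cases h : G.freeAct (a : FreeGen V E) s <;> rfl
    | coe b =>
      rw [← WithZero.coe_mul, freeAct_coe, FreeMonoid.toList_mul, List.foldlM_append]
      rfl

/-- The congruence of having the same action on the states of the stack machine. -/
noncomputable def actCon (G : DiMultigraph V E) : Con (FreeGen V E) where
  r a b := G.freeAct a = G.freeAct b
  iseqv := ⟨fun _ => rfl, fun h => h.symm, fun h h' => h.trans h'⟩
  mul' {a b c d} h h' := by
    funext s
    change G.freeAct a = G.freeAct b at h
    change G.freeAct c = G.freeAct d at h'
    rw [freeAct_mul, freeAct_mul, h, h']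

theorem freeAct_of (G : DiMultigraph V E) (a : GraphInvGen V E) (s : V × List E) :
    G.freeAct ((FreeMonoid.of a : FreeMonoid (GraphInvGen V E)) : FreeGen V E) s =
      G.genStep s a := by
  rw [freeAct_coe, FreeMonoid.toList_of]
  simp

/-- Each defining relation holds between the partial maps, so the action factors through the
semigroup. This is how products are shown to be nonzero. -/
theorem conGen_le_actCon (G : DiMultigraph V E) : conGen G.GraphInvRel ≤ G.actCon := by
  rw [Con.conGen_le]
  intro a b h
  change G.freeAct a = G.freeAct b
  funext ⟨u, l⟩
  induction h with
  | idem v =>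
    simp only [freeAct_mul, genP, freeAct_of]
    by_cases h : u = v <;> simp [freeAct_of, genStep, h]
  | orth v w hvw =>
    simp only [freeAct_mul, genP, freeAct_of, freeAct_zero]
    by_cases h : u = v
    · subst h; simp [freeAct_of, genStep, hvw]
    · simp [freeAct_of, genStep, h]
  | src_neg e =>
    simp only [freeAct_mul, genP, genNeg, freeAct_of]
    by_cases h : u = G.src e <;> simp [freeAct_of, genStep, h]
  | neg_tgt e =>
    simp only [freeAct_mul, genP, genNeg, freeAct_of]
    by_cases h : u = G.src e <;> simp [freeAct_of, genStep, h]
  | tgt_pos e =>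
    simp only [freeAct_mul, genP, genPos, freeAct_of]
    by_cases h : u = G.tgt e
    · subst h; simp [freeAct_of, genStep]
    · simp [genStep, h]
  | pos_src e =>
    simp only [freeAct_mul, genP, genPos, freeAct_of]
    by_cases h : u = G.tgt e ∧ l.head? = some e <;> simp [freeAct_of, genStep, h]
  | cancel e =>
    simp only [freeAct_mul, genP, genPos, genNeg, freeAct_of]
    by_cases h : u = G.src e <;> simp [freeAct_of, genStep, h]
  | neg_pos f g hfg =>
    simp only [freeAct_mul, genPos, genNeg, freeAct_of, freeAct_zero]
    by_cases h : u = G.src f <;> simp [freeAct_of, genStep, h, hfg]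
  | pos_neg f g hfg =>
    simp only [freeAct_mul, genPos, genNeg, freeAct_of, freeAct_zero]
    by_cases h : u = G.tgt g ∧ l.head? = some g <;> simp [freeAct_of, genStep, h, Ne.symm hfg]
  | neg_neg f g hfg =>
    simp only [freeAct_mul, genNeg, freeAct_of, freeAct_zero]
    by_cases h : u = G.src f <;> simp [freeAct_of, genStep, h, hfg]

/-- Running the stack machine on a word in the letters `e⁻`, `e⁺`. -/
noncomputable def run (G : DiMultigraph V E) (w : List (DyckLetter E)) (s : V × List E) :
    Option (V × List E) :=
  w.foldlM (fun s a => G.genStep s (.letter a)) s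

@[simp] theorem run_nil (G : DiMultigraph V E) (s : V × List E) : G.run [] s = some s := rfl

theorem run_cons (G : DiMultigraph V E) (a : DyckLetter E) (w : List (DyckLetter E))
    (s : V × List E) : G.run (a :: w) s = (G.genStep s (.letter a)).bind (G.run w) := rfl

theorem run_append (G : DiMultigraph V E) (w w' : List (DyckLetter E)) (s : V × List E) :
    G.run (w ++ w') s = (G.run w s).bind (G.run w') := by
  simp only [run, List.foldlM_append]
  rfl

theorem wordProd_eq (G : DiMultigraph V E) (w : List (DyckLetter E)) :
    G.wordProd w = (((FreeMonoid.ofList (w.map GraphInvGen.letter) :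
      FreeMonoid (GraphInvGen V E)) : FreeGen V E) : G.GraphInvSemigroup) := by
  induction w with
  | nil => rfl
  | cons a w ih =>
    have h : G.wordProd (a :: w) = (((FreeMonoid.of (GraphInvGen.letter a) :
      FreeMonoid (GraphInvGen V E)) : FreeGen V E) : G.GraphInvSemigroup) * G.wordProd w := by
      simp [wordProd]
    rw [h, ih, ← Con.coe_mul, ← WithZero.coe_mul]
    rfl

theorem wordProd_ne_zero_of_run (G : DiMultigraph V E) {w : List (DyckLetter E)}
    {s s' : V × List E} (h : G.run w s = some s') :
    G.wordProd w ≠ ((0 : FreeGen V E) : G.GraphInvSemigroup) := by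
  intro h0
  rw [wordProd_eq, Con.eq] at h0
  have h1 : G.freeAct _ = G.freeAct 0 := G.conGen_le_actCon h0
  have h2 := congrFun h1 s
  rw [freeAct_zero, freeAct_coe, FreeMonoid.toList_ofList, List.foldlM_map] at h2
  change G.run w s = none at h2
  rw [h] at h2
  cases h2

/-- A letter inspects only the top of the stack, so edges added at the bottom are inert. -/
theorem genStep_extend (G : DiMultigraph V E) {a : DyckLetter E} {u u' : V} {l l' : List E}
    (h : G.genStep (u, l) (.letter a) = some (u', l')) (m : List E) :
    G.genStep (u, l ++ m) (.letter a) = some (u', l' ++ m) := by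
  cases a with
  | neg e =>
    by_cases hu : u = G.src e
    · simp only [genStep, hu, if_true, Option.some.injEq, Prod.mk.injEq] at h
      simp [genStep, hu, ← h.1, ← h.2]
    · simp [genStep, hu] at h
  | pos e =>
    by_cases hu : u = G.tgt e ∧ l.head? = some e
    · rcases l with _ | ⟨f, l⟩
      · simp at hu
      · obtain ⟨rfl, hf⟩ := hu
        simp only [List.head?_cons, Option.some.injEq] at hf
        subst hf
        simp only [genStep, List.head?_cons, and_self, if_true, List.tail_cons, Option.some.injEq,
          Prod.mk.injEq] at h
        simp [genStep, ← h.1, ← h.2]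
    · simp only [genStep, hu, if_false] at h
      cases h

theorem run_extend (G : DiMultigraph V E) {w : List (DyckLetter E)} {u u' : V} {l l' : List E}
    (h : G.run w (u, l) = some (u', l')) (m : List E) :
    G.run w (u, l ++ m) = some (u', l' ++ m) := by
  induction w generalizing u l with
  | nil =>
    simp only [run_nil, Option.some.injEq, Prod.mk.injEq] at h
    simp [h.1, h.2]
  | cons a w ih =>
    rw [run_cons, Option.bind_eq_some_iff] at h
    obtain ⟨⟨u₁, l₁⟩, h₁, h₂⟩ := h
    rw [run_cons, G.genStep_extend h₁ m]
    exact ih h₂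

theorem run_extend_nil (G : DiMultigraph V E) {w : List (DyckLetter E)} {u u' : V} {l' : List E}
    (h : G.run w (u, []) = some (u', l')) (m : List E) :
    G.run w (u, m) = some (u', l' ++ m) :=
  G.run_extend h m

end StackMachine

/-! ### First return loops form a prefix code -/

section FirstPassage

/-- `c` is a nonempty path from `u` to `v` that visits `v` only at its end. -/
def IsFirstPassage (G : DiMultigraph V E) (v : V) : V → List E → Prop
  | _, [] => False
  | u, e :: c => G.src e = u ∧ ((c = [] ∧ G.tgt e = v) ∨ (G.tgt e ≠ v ∧ IsFirstPassage G v (G.tgt e) c))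

/-- The first return loops at `v`. -/
abbrev Loop (G : DiMultigraph V E) (v : V) := {c : List E // G.IsFirstPassage v v c}

variable {G : DiMultigraph V E} {v : V}

theorem IsFirstPassage.ne_nil {u : V} {c : List E} (h : G.IsFirstPassage v u c) : c ≠ [] := by
  rintro rfl
  exact h

/-- A first passage path stops at its first arrival at `v`, so it cannot be prolonged to another
one. -/
theorem IsFirstPassage.eq_of_prefix {u : V} {c c' : List E} (h : G.IsFirstPassage v u c)
    (h' : G.IsFirstPassage v u c') (hp : c <+: c') : c = c' := by
  induction c generalizing u c' with
  | nil => exact h.elim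
  | cons e c ih =>
    rcases c' with _ | ⟨f, c'⟩
    · exact h'.elim
    · rw [List.cons_prefix_cons] at hp
      obtain ⟨rfl, hp⟩ := hp
      obtain ⟨-, ⟨rfl, ht⟩ | ⟨ht, hc⟩⟩ := h
      · obtain ⟨-, ⟨rfl, -⟩ | ⟨ht', -⟩⟩ := h'
        · rfl
        · exact absurd ht ht'
      · obtain ⟨-, ⟨-, ht'⟩ | ⟨-, hc'⟩⟩ := h'
        · exact absurd ht' ht
        · rw [ih hc hc' hp]

theorem IsFirstPassage.run_neg {u : V} {c : List E} (h : G.IsFirstPassage v u c) (l : List E) :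
    G.run (c.map .neg) (u, l) = some (v, c.reverse ++ l) := by
  induction c generalizing u l with
  | nil => exact h.elim
  | cons e c ih =>
    obtain ⟨rfl, hc⟩ := h
    rw [List.map_cons, run_cons]
    simp only [genStep, if_true, Option.bind_some]
    rcases hc with ⟨rfl, ht⟩ | ⟨-, hc⟩
    · simp [ht]
    · simp [ih hc]

theorem IsFirstPassage.run_pos {u : V} {c : List E} (h : G.IsFirstPassage v u c) (l : List E) :
    G.run (c.reverse.map .pos) (v, c.reverse ++ l) = some (u, l) := by
  induction c generalizing u l with
  | nil => exact h.elim
  | cons e c ih =>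
    obtain ⟨rfl, hc⟩ := h
    rw [List.reverse_cons, List.map_append, run_append]
    rcases hc with ⟨rfl, ht⟩ | ⟨-, hc⟩
    · simp [run_cons, genStep, ht]
    · rw [List.append_assoc, ih hc]
      simp [run_cons, genStep]

theorem Loop.eq_of_map_neg_append {c c' : G.Loop v} {w w' : List (DyckLetter E)}
    (h : c.1.map DyckLetter.neg ++ w = c'.1.map DyckLetter.neg ++ w') : c = c' := by
  have hinj : Function.Injective (DyckLetter.neg : E → DyckLetter E) := fun a b hab => by
    cases hab; rfl
  rcases List.prefix_or_prefix_of_prefix (List.prefix_append (c.1.map DyckLetter.neg) w)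
    (h ▸ List.prefix_append (c'.1.map DyckLetter.neg) w') with hp | hp
  · exact Subtype.ext (c.2.eq_of_prefix c'.2 ((List.prefix_map_iff_of_injective hinj).1 hp))
  · exact Subtype.ext (c'.2.eq_of_prefix c.2 ((List.prefix_map_iff_of_injective hinj).1 hp)).symm

end FirstPassage

/-! ### Unique decomposition of words -/

section Words

/-- The words in `e⁻`, `e⁺` whose product is `P_v`, as seen by the stack machine. -/
abbrev DyckWord (G : DiMultigraph V E) (v : V) :=
  {w : List (DyckLetter E) // G.run w (v, []) = some (v, [])}

/-- The words in `e⁻`, `e⁺` whose product is the negative word of a closed path at `v`. -/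
abbrev NegWord (G : DiMultigraph V E) (v : V) :=
  {w : List (DyckLetter E) // ∃ l, G.run w (v, []) = some (v, l)}

variable {G : DiMultigraph V E} {v : V}

/-- The Dyck words `c⁻ d c⁺ d'`. -/
def DyckWord.join (x : G.Loop v × G.DyckWord v × G.DyckWord v) : G.DyckWord v :=
  ⟨x.1.1.map .neg ++ (x.2.1.1 ++ (x.1.1.reverse.map .pos ++ x.2.2.1)), by
    rw [run_append, x.1.2.run_neg, Option.bind_some, run_append, G.run_extend_nil x.2.1.2,
      Option.bind_some, run_append]
    simp only [List.nil_append]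
    rw [x.1.2.run_pos, Option.bind_some, x.2.2.2]⟩

/-- The words `d c⁻ w`. -/
def NegWord.join (x : G.DyckWord v × G.Loop v × G.NegWord v) : G.NegWord v :=
  ⟨x.1.1 ++ (x.2.1.1.map .neg ++ x.2.2.1), by
    obtain ⟨l, hl⟩ := x.2.2.2
    refine ⟨l ++ x.2.1.1.reverse, ?_⟩
    rw [run_append, x.1.2, Option.bind_some, run_append, x.2.1.2.run_neg, Option.bind_some,
      G.run_extend_nil hl, List.append_nil]⟩

theorem DyckWord.suffix {d d' : G.DyckWord v} {x : List (DyckLetter E)} (h : d'.1 = d.1 ++ x) :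
    G.run x (v, []) = some (v, []) := by
  have := d'.2
  rwa [h, run_append, d.2, Option.bind_some] at this

/-- Nothing can be popped from an empty stack. This marks where d ends in c⁻ d c⁺ d'. -/
theorem run_pos_append_ne {c : List E} (hc : c ≠ []) {x y z : List (DyckLetter E)}
    (hx : G.run x (v, []) = some (v, [])) (h : c.map DyckLetter.pos ++ y = x ++ z) : x = [] := by
  rcases x with _ | ⟨a, x⟩
  · rfl
  · obtain ⟨e, c, rfl⟩ := List.exists_cons_of_ne_nil hc
    simp only [List.map_cons, List.cons_append, List.cons.injEq] at h
    rw [← h.1, run_cons] at hx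
    simp [genStep] at hx

/-- The first edge pushed by c⁻ is never popped by what follows, so the stack is never empty again.
This marks where d ends in d c⁻ w. -/
theorem run_neg_append_ne {c : List E} (hc : G.IsFirstPassage v v c) {x y z : List (DyckLetter E)}
    {l : List E} (hx : G.run x (v, []) = some (v, [])) (hy : G.run y (v, []) = some (v, l))
    (h : c.map DyckLetter.neg ++ y = x ++ z) : x = [] := by
  rcases x with _ | ⟨a, x⟩
  · rfl
  · exfalso
    rcases c with _ | ⟨e, c⟩
    · exact hc
    simp only [List.map_cons, List.cons_append, List.cons.injEq] at h
    obtain ⟨rfl, h⟩ := h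
    obtain ⟨hs, hc⟩ := hc
    obtain ⟨s, hs'⟩ : ∃ s, G.run (c.map DyckLetter.neg ++ y) (G.tgt e, []) = some s := by
      rcases hc with ⟨rfl, ht⟩ | ⟨-, hc⟩
      · exact ⟨_, by simpa [ht] using hy⟩
      · exact ⟨_, by rw [run_append, hc.run_neg, Option.bind_some, G.run_extend_nil hy]⟩
    rw [h, run_append, Option.bind_eq_some_iff] at hs'
    obtain ⟨⟨u, l'⟩, h₁, -⟩ := hs'
    have h₂ := G.run_extend_nil h₁ [e]
    rw [run_cons] at hx
    simp only [genStep, hs, if_true, Option.bind_some] at hx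
    rw [h₂] at hx
    simp at hx

theorem DyckWord.join_injective : Function.Injective (DyckWord.join (G := G) (v := v)) := by
  rintro ⟨c, d₁, d₂⟩ ⟨c', d₁', d₂'⟩ h
  have h := congrArg Subtype.val h
  simp only [DyckWord.join] at h
  obtain rfl := Loop.eq_of_map_neg_append h
  rw [List.append_cancel_left_eq] at h
  have hc : c.1.reverse ≠ [] := by simpa using c.2.ne_nil
  have h₁ : d₁ = d₁' := by
    rcases List.append_eq_append_iff.1 h with ⟨x, hx, hx'⟩ | ⟨x, hx, hx'⟩
    · have := run_pos_append_ne hc (DyckWord.suffix hx) hx'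
      exact Subtype.ext (by simp [hx, this])
    · have := run_pos_append_ne hc (DyckWord.suffix hx) hx'
      exact Subtype.ext (by simp [hx, this])
  subst h₁
  rw [List.append_cancel_left_eq, List.append_cancel_left_eq] at h
  rw [Subtype.ext h]

theorem NegWord.join_injective : Function.Injective (NegWord.join (G := G) (v := v)) := by
  rintro ⟨d, c, w⟩ ⟨d', c', w'⟩ h
  have h := congrArg Subtype.val h
  simp only [NegWord.join] at h
  obtain ⟨l, hl⟩ := w.2
  obtain ⟨l', hl'⟩ := w'.2
  have h₁ : d = d' := by
    rcases List.append_eq_append_iff.1 h with ⟨x, hx, hx'⟩ | ⟨x, hx, hx'⟩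
    · have := run_neg_append_ne c.2 (DyckWord.suffix hx) hl hx'
      exact Subtype.ext (by simp [hx, this])
    · have := run_neg_append_ne c'.2 (DyckWord.suffix hx) hl' hx'
      exact Subtype.ext (by simp [hx, this])
  subst h₁
  rw [List.append_cancel_left_eq] at h
  obtain rfl := Loop.eq_of_map_neg_append h
  rw [List.append_cancel_left_eq] at h
  rw [Subtype.ext h]

end Words

/-! ### Inequalities between generating functions and the divergence criterion -/

section GeneratingFunctions

open scoped ENNReal

variable {G : DiMultigraph V E} {v : V}

theorem _root_.ENNReal.tsum_sum_type {α β : Type*} (f : α ⊕ β → ℝ≥0∞) :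
    ∑' x, f x = ∑' a, f (.inl a) + ∑' b, f (.inr b) :=
  ENNReal.summable.tsum_sum ENNReal.summable

theorem _root_.ENNReal.tsum_mul_tsum {α β : Type*} (f : α → ℝ≥0∞) (g : β → ℝ≥0∞) :
    ∑' x : α × β, f x.1 * g x.2 = (∑' a, f a) * ∑' b, g b := by
  rw [ENNReal.tsum_prod']
  simp only [ENNReal.tsum_mul_left, ENNReal.tsum_mul_right]

theorem tsum_dyckWord_ge (z : ℝ≥0∞) :
    1 + (∑' c : G.Loop v, (z ^ 2) ^ c.1.length) *
      ((∑' d : G.DyckWord v, z ^ d.1.length) * ∑' d : G.DyckWord v, z ^ d.1.length) ≤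
    ∑' d : G.DyckWord v, z ^ d.1.length := by
  let f : Unit ⊕ (G.Loop v × G.DyckWord v × G.DyckWord v) → G.DyckWord v :=
    Sum.elim (fun _ => ⟨[], rfl⟩) DyckWord.join
  have hf : Function.Injective f := by
    refine Function.Injective.sumElim (fun _ _ _ => rfl) DyckWord.join_injective ?_
    intro _ x h
    have := congrArg Subtype.val h
    simp [DyckWord.join, x.1.2.ne_nil] at this
  refine le_trans (le_of_eq ?_) (ENNReal.tsum_comp_le_tsum_of_injective hf fun d => z ^ d.1.length)
  rw [ENNReal.tsum_sum_type, ← ENNReal.tsum_mul_tsum, ← ENNReal.tsum_mul_tsum]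
  congr 1
  · simp [f]
  · refine tsum_congr fun x => ?_
    simp only [f, Sum.elim_inr, DyckWord.join, List.length_append, List.length_map,
      List.length_reverse]
    ring

theorem tsum_negWord_ge (z : ℝ≥0∞) :
    1 + (∑' d : G.DyckWord v, z ^ d.1.length) * ((∑' c : G.Loop v, z ^ c.1.length) *
      ∑' w : G.NegWord v, z ^ w.1.length) ≤ ∑' w : G.NegWord v, z ^ w.1.length := by
  let f : Unit ⊕ (G.DyckWord v × G.Loop v × G.NegWord v) → G.NegWord v :=
    Sum.elim (fun _ => ⟨[], [], rfl⟩) NegWord.join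
  have hf : Function.Injective f := by
    refine Function.Injective.sumElim (fun _ _ _ => rfl) NegWord.join_injective ?_
    intro _ x h
    have := congrArg Subtype.val h
    simp [NegWord.join, x.2.1.2.ne_nil] at this
  refine le_trans (le_of_eq ?_) (ENNReal.tsum_comp_le_tsum_of_injective hf fun d => z ^ d.1.length)
  rw [ENNReal.tsum_sum_type, ← ENNReal.tsum_mul_tsum, ← ENNReal.tsum_mul_tsum]
  congr 1
  · simp [f]
  · refine tsum_congr fun x => ?_
    simp only [f, Sum.elim_inr, NegWord.join, List.length_append, List.length_map]
    ring

theorem tsum_dyckWord_le_tsum_negWord (z : ℝ≥0∞) :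
    ∑' d : G.DyckWord v, z ^ d.1.length ≤ ∑' w : G.NegWord v, z ^ w.1.length :=
  ENNReal.tsum_comp_le_tsum_of_injective
    (f := fun d : G.DyckWord v => (⟨d.1, [], d.2⟩ : G.NegWord v))
    (fun _ _ h => Subtype.ext (congrArg (fun w : G.NegWord v => w.1) h)) fun w => z ^ w.1.length

/-- If the loops at `v` satisfy `R(z) > 1/2 + √(1/4 - R(z²))`, then the generating function of the
negative words at `v` diverges at `z`. -/
theorem tsum_negWord_eq_top {z : ℝ} (hz : 0 ≤ z)
    (hs : Summable fun c : G.Loop v => z ^ c.1.length)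
    (hs2 : Summable fun c : G.Loop v => (z ^ 2) ^ c.1.length)
    (h : 1 / 2 + √(1 / 4 - ∑' c : G.Loop v, (z ^ 2) ^ c.1.length) <
      ∑' c : G.Loop v, z ^ c.1.length) :
    ∑' w : G.NegWord v, ENNReal.ofReal z ^ w.1.length = ∞ := by
  by_contra hN
  have hD : ∑' d : G.DyckWord v, ENNReal.ofReal z ^ d.1.length ≠ ∞ :=
    ne_top_of_le_ne_top hN (tsum_dyckWord_le_tsum_negWord _)
  have hR : ∑' c : G.Loop v, ENNReal.ofReal z ^ c.1.length =
      ENNReal.ofReal (∑' c : G.Loop v, z ^ c.1.length) := by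
    rw [ENNReal.ofReal_tsum_of_nonneg (fun _ => by positivity) hs]
    simp only [ENNReal.ofReal_pow hz]
  have hR2 : ∑' c : G.Loop v, (ENNReal.ofReal z ^ 2) ^ c.1.length =
      ENNReal.ofReal (∑' c : G.Loop v, (z ^ 2) ^ c.1.length) := by
    rw [ENNReal.ofReal_tsum_of_nonneg (fun _ => by positivity) hs2]
    simp only [ENNReal.ofReal_pow hz, ENNReal.ofReal_pow (pow_nonneg hz 2)]
  have h1 := tsum_dyckWord_ge (G := G) (v := v) (ENNReal.ofReal z)
  have h2 := tsum_negWord_ge (G := G) (v := v) (ENNReal.ofReal z)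
  rw [hR2] at h1
  rw [hR] at h2
  have hR0 : 0 ≤ ∑' c : G.Loop v, z ^ c.1.length := tsum_nonneg fun _ => by positivity
  have hR20 : 0 ≤ ∑' c : G.Loop v, (z ^ 2) ^ c.1.length := tsum_nonneg fun _ => by positivity
  lift (∑' d : G.DyckWord v, ENNReal.ofReal z ^ d.1.length) to NNReal using hD with B
  lift (∑' w : G.NegWord v, ENNReal.ofReal z ^ w.1.length) to NNReal using hN with N
  lift (∑' c : G.Loop v, z ^ c.1.length) to NNReal using hR0 with R
  lift (∑' c : G.Loop v, (z ^ 2) ^ c.1.length) to NNReal using hR20 with R2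
  simp only [ENNReal.ofReal_coe_nnreal] at h1 h2
  have h1' : (1 : ℝ) + R2 * (B * B) ≤ B := by exact_mod_cast h1
  have h2' : (1 : ℝ) + B * (R * N) ≤ N := by exact_mod_cast h2
  have hBpos : (0 : ℝ) < B := by
    have : (0 : ℝ) ≤ R2 * (B * B) := by positivity
    linarith
  -- Divide 1 + R2·B² ≤ B by B² and complete the square in 1/B. The square root needs no sign
  -- condition, as its argument is bounded below by a square.
  have hle : 1 / (B : ℝ) - 1 / 2 ≤ √(1 / 4 - R2) := by
    refine Real.le_sqrt_of_sq_le ?_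
    have : (1 / (B : ℝ) - 1 / 2) ^ 2 = 1 / 4 - R2 - (B - 1 - R2 * (B * B)) / (B * B) := by
      field_simp
      ring
    rw [this]
    have : 0 ≤ ((B : ℝ) - 1 - R2 * (B * B)) / (B * B) := div_nonneg (by linarith) (by positivity)
    linarith
  have hBR : 1 < (B : ℝ) * R := by
    have : 1 / (B : ℝ) < R := by linarith
    rwa [div_lt_iff₀' hBpos] at this
  have hN0 : (0 : ℝ) ≤ N := N.2
  nlinarith

end GeneratingFunctions

end DiMultigraph

/-! ### Determinants and the renewal equation -/

theorem Matrix.eval_charpolyRev_eq_det {R n : Type*} [CommRing R] [Fintype n] [DecidableEq n]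
    (M : Matrix n n R) (z : R) : M.charpolyRev.eval z = (1 - z • M).det := by
  rw [Matrix.charpolyRev, ← Polynomial.coe_evalRingHom, RingHom.map_det]
  congr 1
  ext i j
  by_cases h : i = j
  · subst h; simpa using mul_comm _ _
  · simpa [Matrix.one_apply_ne h] using mul_comm _ _

/-- Replacing row `v` by a unit vector makes the matrix block triangular with a diagonal block equal
to 1. -/
theorem Matrix.adjugate_apply_self {R n : Type*} [CommRing R] [Fintype n] [DecidableEq n]
    (M : Matrix n n R) (v : n) :
    M.adjugate v v = (M.submatrix (Subtype.val : {w // w ≠ v} → n) Subtype.val).det := by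
  rw [Matrix.adjugate_apply, Matrix.twoBlockTriangular_det _ (fun w => w ≠ v)]
  · have hu : Unique {w : n // ¬ w ≠ v} :=
      { default := ⟨v, by simp⟩
        uniq := fun w => Subtype.ext (not_not.1 w.2) }
    have h2 : (Matrix.toSquareBlockProp (M.updateRow v (Pi.single v 1)) fun w => ¬ w ≠ v).det = 1 := by
      rw [Matrix.det_unique]
      have : ∀ w : {w : n // ¬ w ≠ v}, (w : n) = v := fun w => not_not.1 w.2
      simp [Matrix.toSquareBlockProp_def, this]
    rw [h2, mul_one]
    congr 1
    ext i j
    simp [Matrix.toSquareBlockProp_def, Matrix.updateRow_ne i.2]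
  · intro i hi j hj
    obtain rfl := not_not.1 hi
    simp [hj]

namespace DiMultigraph

open scoped ENNReal

variable {V E : Type*}

section PassSum

open Classical in
/-- The generating function of the paths from `u` of length at most `n` that visit `v` only at
their end. -/
noncomputable def passSum (G : DiMultigraph V E) (v : V) (z : ℝ≥0∞) (n : ℕ∞) (u : V) : ℝ≥0∞ :=
  ∑' c : List E, if G.IsFirstPassage v u c ∧ (c.length : ℕ∞) ≤ n then z ^ c.length else 0

/-- A list is empty or has a head and a tail. -/
def listConsEquiv (E : Type*) : Unit ⊕ (E × List E) ≃ List E where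
  toFun := Sum.elim (fun _ => []) fun x => x.1 :: x.2
  invFun
    | [] => .inl ()
    | e :: c => .inr (e, c)
  left_inv x := by rcases x with x | x <;> rfl
  right_inv l := by cases l <;> rfl

theorem tsum_list [Fintype E] (W : List E → ℝ≥0∞) :
    ∑' c, W c = W [] + ∑ e, ∑' c, W (e :: c) := by
  rw [← (listConsEquiv E).tsum_eq, ENNReal.tsum_sum_type, ENNReal.tsum_prod', tsum_fintype,
    tsum_fintype]
  simp [listConsEquiv]

/-- Split off the first edge. With lengths bounded in `ℕ∞`, this is both the inductive step for
finite `n` and a linear system at `n = ⊤`. -/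
theorem passSum_add_one [DecidableEq V] [Fintype E] (G : DiMultigraph V E) (v : V) (z : ℝ≥0∞) (n : ℕ∞) (u : V) :
    G.passSum v z (n + 1) u =
      ∑ e with G.src e = u, z * (if G.tgt e = v then 1 else G.passSum v z n (G.tgt e)) := by
  rw [passSum, tsum_list, Finset.sum_filter, if_neg fun h => h.1, zero_add]
  refine Finset.sum_congr rfl fun e _ => ?_
  have hcons : ∀ c, G.IsFirstPassage v u (e :: c) ↔ G.src e = u ∧
      ((c = [] ∧ G.tgt e = v) ∨ (G.tgt e ≠ v ∧ G.IsFirstPassage v (G.tgt e) c)) := fun _ => Iff.rfl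
  by_cases hs : G.src e = u
  · by_cases ht : G.tgt e = v
    · rw [tsum_eq_single []]
      · simp [hcons, hs, ht]
      · intro c hc
        simp [hcons, hc, ht]
    · rw [if_pos hs, if_neg ht, passSum, ← ENNReal.tsum_mul_left]
      refine tsum_congr fun c => ?_
      have hlen : ((List.length (e :: c) : ℕ) : ℕ∞) ≤ n + 1 ↔ (c.length : ℕ∞) ≤ n := by
        rw [List.length_cons, Nat.cast_add, Nat.cast_one]
        exact ENat.add_le_add_iff_right ENat.one_ne_top
      have hpass : G.IsFirstPassage v u (e :: c) ↔ G.IsFirstPassage v (G.tgt e) c := by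
        rw [hcons]
        simp [hs, ht]
      by_cases h : G.IsFirstPassage v (G.tgt e) c ∧ (c.length : ℕ∞) ≤ n
      · rw [if_pos h, if_pos ⟨hpass.2 h.1, hlen.2 h.2⟩, List.length_cons, pow_succ']
      · rw [if_neg h, if_neg fun h' => h ⟨hpass.1 h'.1, hlen.1 h'.2⟩, mul_zero]
  · simp [hcons, hs]

theorem passSum_zero (G : DiMultigraph V E) (v : V) (z : ℝ≥0∞) (u : V) :
    G.passSum v z 0 u = 0 := by
  rw [passSum, ENNReal.tsum_eq_zero]
  intro c
  rcases c with _ | ⟨e, c⟩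
  · simp [IsFirstPassage]
  · rw [if_neg]
    rintro ⟨-, h⟩
    simp at h

theorem passSum_top_le (G : DiMultigraph V E) (v : V) (z : ℝ≥0∞) (u : V) {b : ℝ≥0∞}
    (h : ∀ n : ℕ, G.passSum v z n u ≤ b) : G.passSum v z ⊤ u ≤ b := by
  rw [passSum, ENNReal.tsum_eq_iSup_sum]
  refine iSup_le fun s => le_trans ?_ (h (s.sup List.length))
  rw [passSum]
  refine le_trans ?_ (ENNReal.sum_le_tsum s)
  refine Finset.sum_le_sum fun c hc => ?_
  have : (c.length : ℕ∞) ≤ (s.sup List.length : ℕ) := by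
    exact_mod_cast Finset.le_sup (f := List.length) hc
  by_cases hp : G.IsFirstPassage v u c
  · rw [if_pos ⟨hp, le_top⟩, if_pos ⟨hp, this⟩]
  · rw [if_neg fun h => hp h.1]
    exact zero_le

theorem passSum_top_self (G : DiMultigraph V E) (v : V) (z : ℝ≥0∞) :
    G.passSum v z ⊤ v = ∑' c : G.Loop v, z ^ c.1.length := by
  rw [passSum]
  refine Eq.trans ?_ (tsum_subtype {c | G.IsFirstPassage v v c} fun c => z ^ c.length).symm
  refine tsum_congr fun c => ?_
  by_cases h : G.IsFirstPassage v v c <;> simp [h]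

end PassSum

section Determinants

variable [Fintype V] [DecidableEq V] [Fintype E] {G : DiMultigraph V E} {v : V}
  {x : V → ℝ} {lam z : ℝ}

theorem adjMatrix_mulVec (G : DiMultigraph V E) (g : V → ℝ) (u : V) :
    (G.adjMatrix ℝ).mulVec g u = ∑ e with G.src e = u, g (G.tgt e) := by
  classical
  have h : ∀ w, G.adjMatrix ℝ u w * g w = ∑ e with G.src e = u ∧ G.tgt e = w, g (G.tgt e) := by
    intro w
    rw [Finset.sum_congr rfl (g := fun _ => g w) fun e he => by
      rw [(Finset.mem_filter.1 he).2.2], Finset.sum_const, nsmul_eq_mul]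
    congr 2
    rw [← Set.ncard_coe_finset]
    simp [adjMatrix]
  simp only [Matrix.mulVec, dotProduct, h]
  rw [← Finset.sum_fiberwise (Finset.univ.filter fun e => G.src e = u) G.tgt]
  simp only [Finset.filter_filter]

/-- The vector `x u / x v` takes the value 1 at `v` and is a supersolution of the recursion when `z
* lam ≤ 1`. -/
theorem passSum_le (hx : ∀ u, 0 < x u) (hA : (G.adjMatrix ℝ).mulVec x = lam • x) (hz : 0 ≤ z)
    (hzl : z * lam ≤ 1) (u : V) :
    G.passSum v (ENNReal.ofReal z) ⊤ u ≤ ENNReal.ofReal (x u / x v) := by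
  refine passSum_top_le _ _ _ _ fun n => ?_
  induction n generalizing u with
  | zero => rw [Nat.cast_zero, passSum_zero]; exact zero_le
  | succ n ih =>
    rw [Nat.cast_add, Nat.cast_one, passSum_add_one]
    have h1 : ∀ e, ENNReal.ofReal z *
        (if G.tgt e = v then 1 else G.passSum v (ENNReal.ofReal z) n (G.tgt e)) ≤
        ENNReal.ofReal (z * (x (G.tgt e) / x v)) := by
      intro e
      rw [ENNReal.ofReal_mul hz]
      gcongr
      split_ifs with h
      · rw [h, div_self (hx v).ne', ENNReal.ofReal_one]
      · exact ih _
    refine (Finset.sum_le_sum fun e _ => h1 e).trans ?_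
    rw [← ENNReal.ofReal_sum_of_nonneg fun e _ =>
      mul_nonneg hz (div_nonneg (hx _).le (hx _).le)]
    refine ENNReal.ofReal_le_ofReal ?_
    have h2 := congrFun hA u
    rw [adjMatrix_mulVec, Pi.smul_apply, smul_eq_mul] at h2
    rw [← Finset.mul_sum, ← Finset.sum_div, h2, mul_div_assoc', ← mul_assoc]
    have := hx u
    have := hx v
    gcongr
    nlinarith

theorem summable_loop (hx : ∀ u, 0 < x u) (hA : (G.adjMatrix ℝ).mulVec x = lam • x) (hz : 0 ≤ z)
    (hzl : z * lam ≤ 1) : Summable fun c : G.Loop v => z ^ c.1.length := by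
  have h := ne_top_of_le_ne_top ENNReal.ofReal_ne_top
    (passSum_le (G := G) (v := v) hx hA hz hzl v)
  rw [passSum_top_self] at h
  refine (ENNReal.summable_toReal h).congr fun c => ?_
  simp [ENNReal.toReal_pow, ENNReal.toReal_ofReal hz]

/-- The renewal equation `p(z) = (1 - R(z)) p_v(z)`. -/
theorem eval_p_eq (hx : ∀ u, 0 < x u) (hA : (G.adjMatrix ℝ).mulVec x = lam • x) (hz : 0 ≤ z)
    (hzl : z * lam ≤ 1) :
    G.p.eval z = (1 - ∑' c : G.Loop v, z ^ c.1.length) * (G.pDel v).eval z := by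
  have hfin : ∀ u, G.passSum v (ENNReal.ofReal z) ⊤ u ≠ ∞ := fun u =>
    ne_top_of_le_ne_top ENNReal.ofReal_ne_top (passSum_le hx hA hz hzl u)
  set f : V → ℝ := fun u => (G.passSum v (ENNReal.ofReal z) ⊤ u).toReal with hf
  -- Setting the value 1 at `v` absorbs the case distinction of the recursion: f = zAg, so (1 - zA)g
  -- is supported at `v`.
  set g : V → ℝ := fun u => if u = v then 1 else f u with hg
  have hfg : ∀ u, f u = z * (G.adjMatrix ℝ).mulVec g u := by
    intro u
    have h := G.passSum_add_one v (ENNReal.ofReal z) ⊤ u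
    rw [top_add] at h
    simp only [hf]
    rw [h, adjMatrix_mulVec, ENNReal.toReal_sum, Finset.mul_sum]
    · refine Finset.sum_congr rfl fun e _ => ?_
      rw [ENNReal.toReal_mul, ENNReal.toReal_ofReal hz]
      congr 1
      simp only [hg, hf]
      split_ifs <;> simp
    · intro e _
      refine ENNReal.mul_ne_top ENNReal.ofReal_ne_top ?_
      split_ifs
      · exact ENNReal.one_ne_top
      · exact hfin _
  have hfv : f v = ∑' c : G.Loop v, z ^ c.1.length := by
    simp only [hf]
    rw [passSum_top_self, ENNReal.tsum_toReal_eq fun c =>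
      ENNReal.pow_ne_top ENNReal.ofReal_ne_top]
    simp [ENNReal.toReal_pow, ENNReal.toReal_ofReal hz]
  have hsys : (1 - z • G.adjMatrix ℝ).mulVec g = Pi.single v (1 - f v) := by
    ext u
    rw [Matrix.sub_mulVec, Matrix.one_mulVec, Matrix.smul_mulVec, Pi.sub_apply, Pi.smul_apply,
      smul_eq_mul, ← hfg]
    by_cases h : u = v
    · subst h; simp [hg]
    · simp [hg, h]
  -- Multiply by the adjugate and read off the entry at `v`, where g = 1 and the diagonal cofactor
  -- is p_v(z).
  have hadj := congrArg (fun y => (1 - z • G.adjMatrix ℝ).adjugate.mulVec y v) hsys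
  simp only [Matrix.mulVec_mulVec, Matrix.adjugate_mul, Matrix.smul_mulVec, Matrix.one_mulVec,
    Pi.smul_apply, smul_eq_mul, Matrix.mulVec_single] at hadj
  rw [p, pDel, Matrix.eval_charpolyRev_eq_det, Matrix.eval_charpolyRev_eq_det, ← hfv]
  have hgv : g v = 1 := by simp [hg]
  rw [hgv, mul_one] at hadj
  rw [hadj]
  simp only [Matrix.col_apply, Matrix.adjugate_apply_self, MulOpposite.smul_eq_mul_unop,
    MulOpposite.unop_op]
  rw [mul_comm]
  congr 2
  ext i j
  simp [Matrix.one_apply, Subtype.ext_iff]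

/-- Maximum principle: extend a kernel vector by 0 at `v` to `Y`. The vertices where |Y|/x is
maximal are closed under successors, so by strong connectivity they include `v`, where `Y` vanishes.
-/
theorem eval_pDel_ne_zero (hG : G.StronglyConnected) (hx : ∀ u, 0 < x u)
    (hA : (G.adjMatrix ℝ).mulVec x = lam • x) (hz : 0 < z) (hzl : z * lam ≤ 1) :
    (G.pDel v).eval z ≠ 0 := by
  rw [pDel, Matrix.eval_charpolyRev_eq_det]
  intro h0
  obtain ⟨y, hy0, hy⟩ := Matrix.exists_mulVec_eq_zero_iff.2 h0
  rw [Matrix.sub_mulVec, Matrix.one_mulVec, Matrix.smul_mulVec, sub_eq_zero] at hy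
  set Y : V → ℝ := fun u => if h : u ≠ v then y ⟨u, h⟩ else 0 with hY
  have hYv : Y v = 0 := by simp [hY]
  have hYeq : ∀ u, u ≠ v → Y u = z * ∑ e with G.src e = u, Y (G.tgt e) := by
    intro u hu
    rw [← adjMatrix_mulVec]
    have h1 := congrFun hy ⟨u, hu⟩
    have h2 : Y u = y ⟨u, hu⟩ := by simp [hY, hu]
    rw [h2, h1, Pi.smul_apply, smul_eq_mul]
    congr 1
    simp only [Matrix.mulVec, dotProduct, Matrix.submatrix_apply]
    rw [← Finset.sum_subset (Finset.filter_subset (· ≠ v) Finset.univ) fun w _ hw => by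
      have : w = v := by simpa using hw
      rw [this, hYv, mul_zero], Finset.sum_subtype _ (p := (· ≠ v)) (by simp)]
    exact Finset.sum_congr rfl fun w _ => by simp [hY, w.2]
  obtain ⟨i, hi⟩ := Function.ne_iff.1 hy0
  obtain ⟨u₀, -, hu₀⟩ := Finset.exists_max_image Finset.univ (fun u => |Y u| / x u) ⟨v, by simp⟩
  set t := |Y u₀| / x u₀
  have ht : ∀ u, |Y u| ≤ t * x u := fun u => by
    have := hu₀ u (Finset.mem_univ u)
    rwa [div_le_iff₀ (hx u)] at this
  have htpos : 0 < t := by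
    have h1 : Y i.1 = y i := by simp [hY, i.2]
    have h2 : 0 < |Y i.1| := abs_pos.2 (by rw [h1]; exact hi)
    exact pos_of_mul_pos_left (h2.trans_le (ht i.1)) (hx _).le
  have hne : ∀ u, |Y u| = t * x u → u ≠ v := by
    rintro u h rfl
    rw [hYv, abs_zero] at h
    exact (mul_pos htpos (hx u)).ne h
  have hstep : ∀ e, |Y (G.src e)| = t * x (G.src e) → |Y (G.tgt e)| = t * x (G.tgt e) := by
    intro e he
    by_contra hlt
    have hlt := lt_of_le_of_ne (ht (G.tgt e)) hlt
    have h1 : ∑ e' with G.src e' = G.src e, |Y (G.tgt e')| <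
        ∑ e' with G.src e' = G.src e, t * x (G.tgt e') :=
      Finset.sum_lt_sum (fun _ _ => ht _) ⟨e, by simp, hlt⟩
    have h2 := congrFun hA (G.src e)
    rw [adjMatrix_mulVec, Pi.smul_apply, smul_eq_mul] at h2
    rw [← Finset.mul_sum, h2] at h1
    have h3 : |Y (G.src e)| ≤ z * ∑ e' with G.src e' = G.src e, |Y (G.tgt e')| := by
      rw [hYeq _ (hne _ he), abs_mul, abs_of_pos hz]
      exact mul_le_mul_of_nonneg_left (Finset.abs_sum_le_sum_abs _ _) hz.le
    rw [he] at h3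
    have h4 := mul_lt_mul_of_pos_left h1 hz
    have h5 : z * (t * (lam * x (G.src e))) = (z * lam) * (t * x (G.src e)) := by ring
    have h6 : 0 < t * x (G.src e) := mul_pos htpos (hx _)
    nlinarith
  have hall : ∀ w, |Y w| = t * x w := by
    intro w
    induction hG u₀ w with
    | refl => exact (div_mul_cancel₀ _ (hx u₀).ne').symm
    | tail _ h ih =>
      obtain ⟨e, rfl, rfl⟩ := h
      exact hstep e ih
  exact hne v (hall v) rfl

end Determinants

end DiMultigraph

open Filter Topology

/-! ### The Newton step -/

section LoopSeries

variable {ι : Type*} {ℓ : ι → ℕ} {ρ : ℝ}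

theorem summable_sq_pow (hρ : 0 < ρ) (hρ1 : ρ < 1) (hs : Summable fun i => ρ ^ ℓ i) :
    Summable fun i => (ρ ^ 2) ^ ℓ i := by
  refine Summable.of_nonneg_of_le (fun _ => by positivity) (fun i => ?_) hs
  exact pow_le_pow_left₀ (by positivity) (by nlinarith) _

theorem sq_pow_le (hℓ : ∀ i, 1 ≤ ℓ i) (hρ : 0 < ρ) (hρ1 : ρ < 1) (i : ι) :
    (ρ ^ 2) ^ ℓ i ≤ ρ * ρ ^ ℓ i := by
  have h1 : ρ ^ ℓ i ≤ ρ ^ 1 := pow_le_pow_of_le_one hρ.le hρ1.le (hℓ i)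
  have h2 : 0 < ρ ^ ℓ i := by positivity
  calc (ρ ^ 2) ^ ℓ i = ρ ^ ℓ i * ρ ^ ℓ i := by rw [← pow_mul, mul_comm, pow_mul, sq]
    _ ≤ ρ * ρ ^ ℓ i := by rw [pow_one] at h1; gcongr

theorem tsum_sq_pow_le (hℓ : ∀ i, 1 ≤ ℓ i) (hρ : 0 < ρ) (hρ1 : ρ < 1)
    (hs : HasSum (fun i => ρ ^ ℓ i) 1) : ∑' i, (ρ ^ 2) ^ ℓ i ≤ ρ := by
  refine (Summable.tsum_le_tsum (sq_pow_le hℓ hρ hρ1) (summable_sq_pow hρ hρ1 hs.summable)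
    (hs.summable.mul_left ρ)).trans (le_of_eq ?_)
  rw [tsum_mul_left, hs.tsum_eq, mul_one]

/-- A Newton step, with respect to the variable `log z`, for the equation
`R(z) = 1/2 + √(1/4 - R(z²))`, started at the point `ρ` with `R(ρ) = 1`. -/
theorem exists_gt_newton_step (hℓ : ∀ i, 1 ≤ ℓ i) (hρ : 0 < ρ) (hρ1 : ρ < 1 / 4)
    (hs : HasSum (fun i => ρ ^ ℓ i) 1) {M c : ℝ} (hM : ∀ s : Finset ι, ∑ i ∈ s, ℓ i * ρ ^ ℓ i ≤ M)
    (hc : c = 1 / 4 - ∑' i, (ρ ^ 2) ^ ℓ i) :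
    ∃ t, (1 / 2 * √c - c) / (M * (ρ + √c)) < t ∧ 0 < t ∧
      1 / 2 + √(1 / 4 - ∑' i, ((ρ * Real.exp (-t)) ^ 2) ^ ℓ i) <
        ∑' i, (ρ * Real.exp (-t)) ^ ℓ i := by
  have hρ' : ρ < 1 := by linarith
  have hs2 := summable_sq_pow hρ hρ' hs.summable
  have hR2 := tsum_sq_pow_le hℓ hρ hρ' hs
  have hsM : Summable fun i => (ℓ i : ℝ) * ρ ^ ℓ i :=
    summable_of_sum_le (fun _ => by positivity) hM
  have hMle : ∑' i, (ℓ i : ℝ) * ρ ^ ℓ i ≤ M := hsM.tsum_le_of_sum_le hM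
  have hM1 : 1 ≤ ∑' i, (ℓ i : ℝ) * ρ ^ ℓ i := by
    rw [← hs.tsum_eq]
    refine Summable.tsum_le_tsum (fun i => ?_) hs.summable hsM
    have h1 : (1 : ℝ) ≤ ℓ i := by exact_mod_cast hℓ i
    have h2 : 0 < ρ ^ ℓ i := by positivity
    nlinarith
  have hKle : ∀ i, (ℓ i : ℝ) * (ρ ^ 2) ^ ℓ i ≤ ρ * (ℓ i * ρ ^ ℓ i) := fun i =>
    (mul_le_mul_of_nonneg_left (sq_pow_le hℓ hρ hρ' i) (Nat.cast_nonneg _)).trans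
      (le_of_eq (by ring))
  have hsK : Summable fun i => (ℓ i : ℝ) * (ρ ^ 2) ^ ℓ i :=
    Summable.of_nonneg_of_le (fun _ => by positivity) hKle (hsM.mul_left ρ)
  have hK : ∑' i, (ℓ i : ℝ) * (ρ ^ 2) ^ ℓ i ≤ ρ * ∑' i, (ℓ i : ℝ) * ρ ^ ℓ i := by
    rw [← tsum_mul_left]
    exact Summable.tsum_le_tsum hKle hsK (hsM.mul_left ρ)
  have hK0 : 0 ≤ ∑' i, (ℓ i : ℝ) * (ρ ^ 2) ^ ℓ i := tsum_nonneg fun _ => by positivity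
  obtain ⟨i₀⟩ : Nonempty ι := by
    by_contra h
    rw [not_nonempty_iff] at h
    have := hs.tsum_eq
    simp at this
  have hR2pos : 0 < ∑' i, (ρ ^ 2) ^ ℓ i := hs2.tsum_pos (fun _ => by positivity) i₀ (by positivity)
  set R2 := ∑' i, (ρ ^ 2) ^ ℓ i
  set K := ∑' i, (ℓ i : ℝ) * (ρ ^ 2) ^ ℓ i
  set M' := ∑' i, (ℓ i : ℝ) * ρ ^ ℓ i
  have hcpos : 0 < c := by linarith
  have hr : 0 < √c := Real.sqrt_pos.2 hcpos
  have hr2 : √c < 1 / 2 := by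
    rw [Real.sqrt_lt' (by norm_num)]
    norm_num
    linarith
  have hrr : √c * √c = c := Real.mul_self_sqrt hcpos.le
  have hMpos : 0 < M := by linarith
  -- The zero of the linearised difference (1/2 - √c) - tM(1 + ρ/√c).
  set τ := (1 / 2 * √c - c) / (M * (ρ + √c)) with hτ
  have hτpos : 0 < τ := div_pos (by nlinarith) (by positivity)
  have hτeq : τ * M * (1 + ρ / √c) = 1 / 2 - √c := by
    rw [hτ]
    nth_rewrite 2 [← hrr]
    field_simp
    ring
  -- The gain of a single loop over the tangent line of the exponential. It is positive at τ, and by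
  -- continuity still compensates at some t > τ.
  set slack : ℝ → ℝ := fun t => ρ ^ ℓ i₀ * (Real.exp (-(ℓ i₀ * t)) - 1 + ℓ i₀ * t) with hslack
  have hn0 : (1 : ℝ) ≤ ℓ i₀ := by exact_mod_cast hℓ i₀
  have hslackpos : 0 < slack τ := by
    have h1 : 0 < (ℓ i₀ : ℝ) * τ := by positivity
    have h2 := Real.add_one_lt_exp (x := -(ℓ i₀ * τ)) (by linarith)
    exact mul_pos (by positivity) (by linarith)
  have hcont : Continuous fun t => (1 / 2 - √c) - t * M * (1 + ρ / √c) + slack t := by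
    simp only [hslack]
    fun_prop
  have hev : ∀ᶠ t in 𝓝[>] τ, 0 < (1 / 2 - √c) - t * M * (1 + ρ / √c) + slack t := by
    refine nhdsWithin_le_nhds (hcont.continuousAt.eventually (lt_mem_nhds ?_))
    change 0 < (1 / 2 - √c) - τ * M * (1 + ρ / √c) + slack τ
    linarith
  obtain ⟨t, ht, hτt⟩ := (hev.and self_mem_nhdsWithin).exists
  have hτt : τ < t := hτt
  have htpos : 0 < t := hτpos.trans hτt
  refine ⟨t, hτt, htpos, ?_⟩
  have hexp : ∀ i, Real.exp (-t) ^ ℓ i = Real.exp (-(ℓ i * t)) := fun i => by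
    rw [← Real.exp_nat_mul]; congr 1; ring
  have hexp1 : Real.exp (-t) < 1 := Real.exp_lt_one_iff.2 (by linarith)
  have hexp0 : 0 < Real.exp (-t) := Real.exp_pos _
  have hzs : Summable fun i => (ρ * Real.exp (-t)) ^ ℓ i := by
    refine Summable.of_nonneg_of_le (fun _ => by positivity) (fun i => ?_) hs.summable
    exact pow_le_pow_left₀ (by positivity) (by nlinarith) _
  have hzs2 : Summable fun i => ((ρ * Real.exp (-t)) ^ 2) ^ ℓ i := by
    refine Summable.of_nonneg_of_le (fun _ => by positivity) (fun i => ?_) hs2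
    refine pow_le_pow_left₀ (by positivity) (pow_le_pow_left₀ (by positivity) (by nlinarith) _) _
  have hRz : 1 - t * M' + slack t ≤ ∑' i, (ρ * Real.exp (-t)) ^ ℓ i := by
    have h1 : ∀ i, (ρ * Real.exp (-t)) ^ ℓ i - ρ ^ ℓ i + t * (ℓ i * ρ ^ ℓ i) =
        ρ ^ ℓ i * (Real.exp (-(ℓ i * t)) - 1 + ℓ i * t) := fun i => by
      rw [mul_pow, hexp]; ring
    have h2 : Summable fun i => (ρ * Real.exp (-t)) ^ ℓ i - ρ ^ ℓ i + t * (ℓ i * ρ ^ ℓ i) :=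
      (hzs.sub hs.summable).add (hsM.mul_left t)
    have h3 := h2.le_tsum i₀ fun i _ => by
      rw [h1]
      have := Real.add_one_le_exp (-(ℓ i * t))
      exact mul_nonneg (by positivity) (by linarith)
    rw [h1, (hzs.sub hs.summable).tsum_add (hsM.mul_left t), hzs.tsum_sub hs.summable,
      tsum_mul_left, hs.tsum_eq] at h3
    simp only [hslack]
    linarith
  have hRz2 : R2 - 2 * t * K ≤ ∑' i, ((ρ * Real.exp (-t)) ^ 2) ^ ℓ i := by
    rw [← tsum_mul_left, ← hs2.tsum_sub (hsK.mul_left _)]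
    refine Summable.tsum_le_tsum (fun i => ?_) (hs2.sub (hsK.mul_left _)) hzs2
    have h1 : ((ρ * Real.exp (-t)) ^ 2) ^ ℓ i = (ρ ^ 2) ^ ℓ i * Real.exp (-(2 * (ℓ i * t))) := by
      rw [mul_pow, mul_pow, ← pow_mul (Real.exp (-t)), mul_comm 2, pow_mul, hexp, ← Real.exp_nat_mul]
      congr 2
      push_cast
      ring
    rw [h1]
    have h2 := Real.add_one_le_exp (-(2 * (ℓ i * t)))
    have h3 : 0 < (ρ ^ 2) ^ ℓ i := by positivity
    nlinarith
  -- Tangent-line bound for the square root: squaring the right side leaves the surplus (tK/√c)².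
  have hsqrt : √(1 / 4 - ∑' i, ((ρ * Real.exp (-t)) ^ 2) ^ ℓ i) ≤ √c + t * K / √c := by
    refine Real.sqrt_le_iff.2 ⟨by positivity, ?_⟩
    have h1 : (√c + t * K / √c) ^ 2 = √c * √c + 2 * t * K + (t * K / √c) ^ 2 := by
      field_simp
      ring
    rw [h1, hrr]
    have := sq_nonneg (t * K / √c)
    linarith
  have h4 : t * K / √c ≤ t * (ρ * M) / √c := by
    gcongr
    exact hK.trans (by gcongr)
  have h5 : t * M' ≤ t * M := by gcongr
  have h6 : t * M * (1 + ρ / √c) = t * M + t * (ρ * M) / √c := by ring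
  linarith

end LoopSeries

theorem HasDerivAt.nonpos_of_le_left {F : ℝ → ℝ} {d a b : ℝ} (hF : HasDerivAt F d b) (hab : a < b)
    (h : ∀ z, a < z → z < b → F b ≤ F z) : d ≤ 0 := by
  have h1 := (hasDerivWithinAt_iff_tendsto_slope' (s := Set.Iio b) (by simp)).1
    hF.hasDerivWithinAt
  refine le_of_tendsto h1 ?_
  filter_upwards [Ioo_mem_nhdsLT hab] with z hz
  rw [slope_def_field]
  exact div_nonpos_of_nonneg_of_nonpos (sub_nonneg.2 (h z hz.1 hz.2)) (sub_nonpos.2 hz.2.le)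

/-! ### The loop series at the inverse Perron eigenvalue -/

namespace DiMultigraph

variable {V E : Type*} [Fintype V] [DecidableEq V] [Fintype E] {G : DiMultigraph V E} {v : V}
  {x : V → ℝ} {lam : ℝ}

theorem hasSum_loop (hG : G.StronglyConnected) (hx : ∀ u, 0 < x u)
    (hA : (G.adjMatrix ℝ).mulVec x = lam • x) (hl : 0 < lam) :
    HasSum (fun c : G.Loop v => lam⁻¹ ^ c.1.length) 1 := by
  have hzl : lam⁻¹ * lam ≤ 1 := (inv_mul_cancel₀ hl.ne').le
  have hs := summable_loop (v := v) hx hA (inv_pos.2 hl).le hzl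
  have h1 := eval_p_eq (v := v) hx hA (inv_pos.2 hl).le hzl
  have h2 : G.p.eval lam⁻¹ = 0 := by
    rw [p, Matrix.eval_charpolyRev_eq_det]
    refine Matrix.exists_mulVec_eq_zero_iff.1 ⟨x, fun h => (hx v).ne' (congrFun h v), ?_⟩
    rw [Matrix.sub_mulVec, Matrix.one_mulVec, Matrix.smul_mulVec, hA, smul_smul,
      inv_mul_cancel₀ hl.ne', one_smul, sub_self]
  rw [h2] at h1
  have h3 := (mul_eq_zero.1 h1.symm).resolve_right
    (eval_pDel_ne_zero hG hx hA (inv_pos.2 hl) hzl)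
  have h4 : ∑' c : G.Loop v, lam⁻¹ ^ c.1.length = 1 := by linarith
  exact h4 ▸ hs.hasSum

/-- On (0, ρ] the function p/p_v plus a finite part of R is 1 minus the remaining part of R, hence
decreasing, so its derivative at ρ is at most 0. This avoids differentiating the infinite series at
the endpoint ρ. -/
theorem sum_length_mul_pow_le (hG : G.StronglyConnected) (hx : ∀ u, 0 < x u)
    (hA : (G.adjMatrix ℝ).mulVec x = lam • x) (hl : 0 < lam) (s : Finset (G.Loop v)) :
    ∑ c ∈ s, (c.1.length : ℝ) * lam⁻¹ ^ c.1.length ≤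
      -(lam⁻¹ * (Polynomial.derivative G.p).eval lam⁻¹ / (G.pDel v).eval lam⁻¹) := by
  have hzl : lam⁻¹ * lam ≤ 1 := (inv_mul_cancel₀ hl.ne').le
  have hρ := inv_pos.2 hl
  have hsum := hasSum_loop (v := v) hG hx hA hl
  set ρ := lam⁻¹
  have hpv := eval_pDel_ne_zero (v := v) hG hx hA hρ hzl
  have hR : ∀ z, 0 < z → z ≤ ρ → G.p.eval z / (G.pDel v).eval z =
      1 - ∑' c : G.Loop v, z ^ c.1.length := by
    intro z hz hzρ
    have h1 : z * lam ≤ 1 := (mul_le_mul_of_nonneg_right hzρ hl.le).trans hzl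
    rw [eval_p_eq (v := v) hx hA hz.le h1, mul_div_cancel_right₀ _ (eval_pDel_ne_zero hG hx hA hz h1)]
  have hp0 : G.p.eval ρ = 0 := by
    have := hR ρ hρ le_rfl
    rw [hsum.tsum_eq, sub_self, div_eq_zero_iff] at this
    exact this.resolve_right hpv
  have hder : HasDerivAt (fun z => G.p.eval z / (G.pDel v).eval z + ∑ c ∈ s, z ^ c.1.length)
      ((Polynomial.derivative G.p).eval ρ / (G.pDel v).eval ρ +
        ∑ c ∈ s, (c.1.length : ℝ) * ρ ^ (c.1.length - 1)) ρ := by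
    refine HasDerivAt.add ?_ (HasDerivAt.fun_sum fun c _ => hasDerivAt_pow _ _)
    have := (G.p.hasDerivAt ρ).fun_div ((G.pDel v).hasDerivAt ρ) hpv
    rw [hp0, zero_mul, sub_zero] at this
    rwa [sq, mul_div_mul_right _ _ hpv] at this
  have hnonpos := hder.nonpos_of_le_left hρ fun z hz hzρ => by
    have hzs : Summable fun c : G.Loop v => z ^ c.1.length :=
      Summable.of_nonneg_of_le (fun _ => by positivity)
        (fun c => pow_le_pow_left₀ hz.le hzρ.le _) hsum.summable
    have h1 := (hsum.summable.sub hzs).sum_le_tsum s fun c _ =>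
      sub_nonneg.2 (pow_le_pow_left₀ hz.le hzρ.le c.1.length)
    rw [hsum.summable.tsum_sub hzs, Finset.sum_sub_distrib] at h1
    simp only [hR z hz hzρ.le, hR ρ hρ le_rfl]
    linarith
  have hmul : ∑ c ∈ s, (c.1.length : ℝ) * ρ ^ c.1.length =
      ρ * ∑ c ∈ s, (c.1.length : ℝ) * ρ ^ (c.1.length - 1) := by
    rw [Finset.mul_sum]
    refine Finset.sum_congr rfl fun c _ => ?_
    obtain ⟨n, hn⟩ := Nat.exists_eq_succ_of_ne_zero
      (Nat.ne_of_gt (List.length_pos_iff.2 c.2.ne_nil))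
    rw [hn, Nat.succ_sub_one, pow_succ]
    ring
  rw [hmul, mul_div_assoc, ← mul_neg]
  exact mul_le_mul_of_nonneg_left (by linarith) hρ.le

end DiMultigraph

open Filter Topology

/-! ### Existence of the entropy and convergence of the word series -/

section Entropy

open scoped ENNReal

variable {A : Type*}

theorem ncard_subshiftWords_add_le [Finite A] (X : Set (ℤ → A)) (m n : ℕ) :
    (subshiftWords X (m + n)).ncard ≤ (subshiftWords X m).ncard * (subshiftWords X n).ncard := by
  rw [← Set.ncard_prod]
  refine Set.ncard_le_ncard_of_injOn
    (fun w => (fun k => w (Fin.castAdd n k), fun k => w (Fin.natAdd m k))) ?_ ?_ (Set.toFinite _)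
  · rintro w ⟨x, hx, i, hw⟩
    refine ⟨⟨x, hx, i, fun k => ?_⟩, ⟨x, hx, i + m, fun k => ?_⟩⟩
    · simp [hw]
    · simp [hw, add_assoc]
  · intro w _ w' _ h
    rw [Prod.mk.injEq] at h
    funext k
    refine Fin.addCases (fun k => congrFun h.1 k) (fun k => congrFun h.2 k) k

/-- The topological entropy of a subshift over a finite alphabet exists. -/
theorem exists_hasTopEntropy [Finite A] (X : Set (ℤ → A)) : ∃ h, HasTopEntropy X h := by
  have hsub : Subadditive fun n => Real.log ((subshiftWords X n).ncard : ℝ) := by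
    intro m n
    have h := ncard_subshiftWords_add_le X m n
    -- If no words exist, `Real.log 0 = 0` keeps the sequence subadditive.
    rcases Nat.eq_zero_or_pos (subshiftWords X (m + n)).ncard with h0 | h0
    · simp only [h0, Nat.cast_zero, Real.log_zero]
      exact add_nonneg (Real.log_natCast_nonneg _) (Real.log_natCast_nonneg _)
    · have hpos := Nat.pos_of_mul_pos_right (h0.trans_le h)
      have hpos' := Nat.pos_of_mul_pos_left (h0.trans_le h)
      rw [← Real.log_mul (by positivity) (by positivity)]
      exact Real.log_le_log (by exact_mod_cast h0) (by exact_mod_cast h)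
  refine ⟨hsub.lim, (hsub.tendsto_lim ⟨0, ?_⟩).congr fun n => ?_⟩
  · rintro _ ⟨n, rfl⟩
    exact div_nonneg (Real.log_natCast_nonneg _) (Nat.cast_nonneg _)
  · rw [div_eq_mul_inv, one_div, mul_comm]

/-- Root test: for h < h' < -log z the terms are eventually below (e^{h'}z)ⁿ, with ratio less than
1. -/
theorem HasTopEntropy.tsum_ne_top {X : Set (ℤ → A)} {h z : ℝ} (hX : HasTopEntropy X h)
    (hz : 0 < z) (hlt : h < -Real.log z) :
    ∑' n : ℕ, ((subshiftWords X n).ncard : ℝ≥0∞) * ENNReal.ofReal z ^ n ≠ ∞ := by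
  obtain ⟨h', hh', hz'⟩ := exists_between hlt
  have hq : Real.exp h' * z < 1 := by
    rw [← Real.exp_log hz, ← Real.exp_add, Real.exp_lt_one_iff]
    linarith
  have hsum : Summable fun n : ℕ => ((subshiftWords X n).ncard : ℝ) * z ^ n := by
    refine Summable.of_norm_bounded_eventually_nat
      (summable_geometric_of_lt_one (by positivity) hq) ?_
    filter_upwards [hX.eventually (gt_mem_nhds hh'), eventually_gt_atTop 0] with n hn hn0
    rw [Real.norm_of_nonneg (by positivity), mul_pow]
    refine mul_le_mul_of_nonneg_right ?_ (by positivity)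
    rcases Nat.eq_zero_or_pos (subshiftWords X n).ncard with h0 | h0
    · rw [h0, Nat.cast_zero]; positivity
    · rw [← Real.exp_nat_mul, ← Real.log_le_iff_le_exp (by exact_mod_cast h0)]
      have hn0' : (0 : ℝ) < n := by exact_mod_cast hn0
      rw [one_div, inv_mul_lt_iff₀ hn0'] at hn
      exact hn.le
  have := hsum.tsum_ofReal_ne_top
  refine ne_of_eq_of_ne (tsum_congr fun n => ?_) this
  rw [ENNReal.ofReal_mul (by positivity), ENNReal.ofReal_pow hz.le, ENNReal.ofReal_natCast]

end Entropy

instance {E : Type*} [Finite E] : Finite (DyckLetter E) :=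
  Finite.of_surjective (Sum.elim DyckLetter.neg DyckLetter.pos : E ⊕ E → DyckLetter E) fun
    | .neg e => ⟨.inl e, rfl⟩
    | .pos e => ⟨.inr e, rfl⟩

namespace DiMultigraph

open scoped ENNReal

variable {V E : Type*}

/-! ### Periodic points carry the negative words into the shift -/

section PeriodicPoints

variable {G : DiMultigraph V E} {v : V}

/-- Powers of `w` run from the empty stack, since each copy only adds to the stack; any block of the
periodic sequence is a factor of such a power. -/
theorem run_periodic (w : List (DyckLetter E)) (hw : 0 < w.length) {l : List E}
    (hl : G.run w (v, []) = some (v, l)) (i m : ℕ) :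
    ∃ s s', G.run ((List.range m).map fun k => w[(i + k) % w.length]'(Nat.mod_lt _ hw)) s =
      some s' := by
  set y : ℕ → DyckLetter E := fun k => w[k % w.length]'(Nat.mod_lt _ hw) with hy
  have hblock : ∀ K : ℕ, ∃ l', G.run ((List.range (K * w.length)).map y) (v, []) = some (v, l') := by
    intro K
    induction K with
    | zero => exact ⟨[], by simp⟩
    | succ K ih =>
      obtain ⟨l', hl'⟩ := ih
      refine ⟨l ++ l', ?_⟩
      have hperiod : ((List.range w.length).map (K * w.length + ·)).map y = w := by
        refine List.ext_getElem (by simp) fun k _ hk => ?_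
        simp [hy, Nat.mod_eq_of_lt hk]
      rw [Nat.succ_mul, List.range_add, List.map_append, run_append, hl', Option.bind_some, hperiod,
        G.run_extend_nil hl]
  obtain ⟨l', hl'⟩ := hblock (i + m)
  have hle : (i + m) * w.length = i + m + ((i + m) * w.length - (i + m)) := by
    have := Nat.le_mul_of_pos_right (i + m) hw
    omega
  rw [hle, List.range_add, List.range_add, List.map_append, List.map_append, run_append,
    Option.bind_eq_some_iff] at hl'
  obtain ⟨s, hs, -⟩ := hl'
  rw [run_append, Option.bind_eq_some_iff] at hs
  obtain ⟨s', -, hs'⟩ := hs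
  rw [List.map_map] at hs'
  exact ⟨s', s, hs'⟩

theorem NegWord.mem_subshiftWords_of_ne_nil (w : G.NegWord v) (hw : w.1 ≠ []) :
    w.1.get ∈ subshiftWords G.markovDyckShift w.1.length := by
  obtain ⟨w, l, hl⟩ := w
  have hpos : 0 < w.length := List.length_pos_iff.2 hw
  have hpos' : (0 : ℤ) < w.length := by exact_mod_cast hpos
  refine ⟨fun i => w[(i % w.length).toNat]'(by
    have := Int.emod_lt_of_pos i hpos'
    have := Int.emod_nonneg i hpos'.ne'
    omega), fun i n => ?_, 0, fun k => ?_⟩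
  · obtain ⟨s, s', hs⟩ := run_periodic w hpos hl (i % w.length).toNat n
    refine G.wordProd_ne_zero_of_run (s := s) (s' := s') (Eq.trans ?_ hs)
    congr 1
    refine List.ext_getElem (by simp) fun k hk _ => ?_
    simp only [List.getElem_ofFn, List.getElem_map, List.getElem_range]
    congr 1
    have := Int.emod_nonneg i hpos'.ne'
    zify
    rw [Int.toNat_of_nonneg this, Int.toNat_of_nonneg (Int.emod_nonneg _ hpos'.ne'),
      Int.emod_add_emod]
  · simp only [List.get_eq_getElem, zero_add]
    congr 1
    rw [Int.emod_eq_of_lt (by positivity) (by exact_mod_cast k.2)]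
    simp

theorem NegWord.mem_subshiftWords (c : G.Loop v) (w : G.NegWord v) :
    w.1.get ∈ subshiftWords G.markovDyckShift w.1.length := by
  -- The empty word has no periodic repetition; it only needs the shift to be nonempty, which the
  -- loop `c` provides.
  by_cases hw : w.1 = []
  · obtain ⟨x, hx, i, -⟩ := NegWord.mem_subshiftWords_of_ne_nil (v := v)
      (⟨c.1.map .neg, _, c.2.run_neg []⟩ : G.NegWord v) (by simpa using c.2.ne_nil)
    refine ⟨x, hx, i, fun k => ?_⟩
    have := k.2
    simp [hw] at this
  · exact w.mem_subshiftWords_of_ne_nil hw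

theorem tsum_negWord_le [Finite E] (c : G.Loop v) (z : ℝ≥0∞) :
    ∑' w : G.NegWord v, z ^ w.1.length ≤
      ∑' n : ℕ, ((subshiftWords G.markovDyckShift n).ncard : ℝ≥0∞) * z ^ n := by
  let f : G.NegWord v → Σ n, subshiftWords G.markovDyckShift n :=
    fun w => ⟨w.1.length, w.1.get, w.mem_subshiftWords c⟩
  have hf : Function.Injective f := by
    intro w w' h
    refine Subtype.ext (List.equivSigmaTuple.injective ?_)
    exact congrArg (fun y : Σ n, subshiftWords G.markovDyckShift n =>
      (⟨y.1, y.2.1⟩ : Σ n, Fin n → DyckLetter E)) h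
  refine (ENNReal.tsum_comp_le_tsum_of_injective hf fun y => z ^ y.1).trans (le_of_eq ?_)
  rw [ENNReal.tsum_sigma']
  refine tsum_congr fun n => ?_
  have := Fintype.ofFinite (subshiftWords G.markovDyckShift n)
  rw [tsum_fintype]
  change ∑ _ : subshiftWords G.markovDyckShift n, z ^ n = _
  rw [Finset.sum_const, nsmul_eq_mul, Finset.card_univ, ← Nat.card_eq_fintype_card]
  rfl

end PeriodicPoints

/-! ### The entropy bound -/

variable [Fintype V] [DecidableEq V] [Fintype E] {G : DiMultigraph V E}

theorem exists_perron [Nonempty E] (hG : G.StronglyConnected) :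
    ∃ (x : V → ℝ) (lam : ℝ), (∀ u, 0 < x u) ∧ (G.adjMatrix ℝ).mulVec x = lam • x ∧ 0 < lam ∧
      G.rho = lam⁻¹ := by
  obtain ⟨e⟩ := ‹Nonempty E›
  have : Nonempty V := ⟨G.src e⟩
  have hnn : ∀ u w, 0 ≤ G.adjMatrix ℝ u w := fun u w => Nat.cast_nonneg _
  have hpos : ∀ u w, (∃ e, G.src e = u ∧ G.tgt e = w) → 0 < G.adjMatrix ℝ u w := fun u w h =>
    Nat.cast_pos.2 ((Set.ncard_pos (Set.toFinite _)).2 h)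
  obtain ⟨x, hx, hA⟩ := Matrix.exists_pos_eigenvector hnn fun u w =>
    Relation.ReflTransGen.mono hpos _ _ (hG u w)
  have hmap : (G.adjMatrix ℝ).map ((↑) : ℝ → ℂ) = G.adjMatrix ℂ := by
    ext u w
    simp [adjMatrix]
  rw [hmap] at hA
  refine ⟨x, _, hx, hA, ?_, rfl⟩
  have h1 := congrFun hA (G.src e)
  rw [adjMatrix_mulVec, Pi.smul_apply, smul_eq_mul] at h1
  have h2 : 0 < ∑ e' with G.src e' = G.src e, x (G.tgt e') :=
    Finset.sum_pos (fun _ _ => hx _) ⟨e, by simp⟩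
  rw [h1] at h2
  exact pos_of_mul_pos_left h2 (hx _).le

theorem entropy_bound [Nonempty E] (hG : G.StronglyConnected) (hρ : G.rho < 1 / 4) (v : V) :
    3 / 4 < G.q v (G.rho ^ 2) ∧ ∀ h, HasTopEntropy G.markovDyckShift h →
      -Real.log G.rho + G.entropyTerm v < h := by
  obtain ⟨x, lam, hx, hA, hl, hrho⟩ := exists_perron hG
  have hρ0 : 0 < G.rho := hrho ▸ inv_pos.2 hl
  have hρl : G.rho * lam = 1 := by rw [hrho, inv_mul_cancel₀ hl.ne']
  have hsum := hasSum_loop (v := v) hG hx hA hl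
  have hM := sum_length_mul_pow_le (v := v) hG hx hA hl
  have hpv := eval_pDel_ne_zero (v := v) hG hx hA hρ0 hρl.le
  rw [← hrho] at hsum hM
  have hlen : ∀ c : G.Loop v, 1 ≤ c.1.length := fun c => List.length_pos_iff.2 c.2.ne_nil
  have hsq : G.rho ^ 2 * lam ≤ 1 := by
    rw [sq, mul_assoc, hρl]
    linarith
  have hq : G.q v (G.rho ^ 2) = 1 - ∑' c : G.Loop v, (G.rho ^ 2) ^ c.1.length := by
    rw [q, eval_p_eq (v := v) hx hA (by positivity) hsq,
      mul_div_cancel_right₀ _ (eval_pDel_ne_zero hG hx hA (by positivity) hsq)]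
  have hR2 := tsum_sq_pow_le hlen hρ0 (by linarith) hsum
  refine ⟨by linarith, fun h hh => ?_⟩
  obtain ⟨t, hτt, ht, hgt⟩ := exists_gt_newton_step hlen hρ0 hρ hsum hM
    (c := G.q v (G.rho ^ 2) - 3 / 4) (by linarith)
  have hterm : G.entropyTerm v < t := by
    refine lt_of_eq_of_lt ?_ hτt
    -- With M = -ρp'(ρ)/p_v(ρ) the Newton step is the stated term; numerator and denominator both
    -- change sign.
    rw [entropyTerm, neg_mul, div_neg, ← neg_div, neg_sub,
      div_mul_eq_mul_div (G.rho * (Polynomial.derivative G.p).eval G.rho),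
      div_div_eq_mul_div, mul_comm ((G.pDel v).eval G.rho)]
  set z := G.rho * Real.exp (-t) with hz
  have hz0 : 0 < z := by positivity
  have hzρ : z ≤ G.rho := mul_le_of_le_one_right hρ0.le (Real.exp_le_one_iff.2 (by linarith))
  have hzl : z * lam ≤ 1 := (mul_le_mul_of_nonneg_right hzρ hl.le).trans hρl.le
  have hzl2 : z ^ 2 * lam ≤ 1 :=
    (mul_le_mul_of_nonneg_right (pow_le_pow_left₀ hz0.le hzρ 2) hl.le).trans hsq
  have htop := tsum_negWord_eq_top hz0.le (summable_loop hx hA hz0.le hzl)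
    (summable_loop hx hA (by positivity) hzl2) hgt
  obtain ⟨c⟩ : Nonempty (G.Loop v) := by
    by_contra hne
    rw [not_nonempty_iff] at hne
    have := hsum.tsum_eq
    simp at this
  have hlog : -Real.log z = -Real.log G.rho + t := by
    rw [hz, Real.log_mul hρ0.ne' (Real.exp_pos _).ne', Real.log_exp]
    ring
  by_contra hle
  have hlt : h < -Real.log z := by linarith [not_lt.1 hle]
  exact hh.tsum_ne_top hz0 hlt (top_le_iff.1 (htop ▸ tsum_negWord_le c _))

end DiMultigraph

theorem corollary3p7 {V E : Type*} [Fintype V] [DecidableEq V] [Fintype E] [Nonempty E]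
    (G : DiMultigraph V E) (hG : G.StronglyConnected) (hρ : G.rho < 1 / 4) :
    ∃ h M : ℝ, HasTopEntropy G.markovDyckShift h ∧
      IsGreatest (G.entropyTerm '' {v : V | 3 / 4 < G.q v (G.rho ^ 2)}) M ∧
      -Real.log G.rho + M < h := by
  obtain ⟨e⟩ := ‹Nonempty E›
  have : Nonempty E := ⟨e⟩
  obtain ⟨h, hh⟩ := exists_hasTopEntropy G.markovDyckShift
  have hb := DiMultigraph.entropy_bound hG hρ
  -- Every vertex satisfies the condition q_v(ρ²) > 3/4, so the maximum may be taken over all of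
  -- `V`.
  obtain ⟨v, -, hv⟩ := Finset.exists_max_image Finset.univ G.entropyTerm ⟨G.src e, Finset.mem_univ _⟩
  refine ⟨h, G.entropyTerm v, hh, ⟨⟨v, (hb v).1, rfl⟩, ?_⟩, (hb v).2 h hh⟩
  rintro _ ⟨w, -, rfl⟩
  exact hv w (Finset.mem_univ w)
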